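/- **Setting.** Let $n\ge 2$, $m\ge 1$, $0<d<1$, and let $G_1,\dots,G_n$ be nontrivial finitely generated groups with fixed finite generating sets $S_1,\dots,S_n$; if $n=2$, assume that $G_1$ and $G_2$ are not both isomorphic to $\mathbb Z/2\mathbb Z$. Let $G_*=G_1*\dots*G_n$, and let $B_i(m)$ be the set of nontrivial elements of the ball of radius $m$ in $G_i$ for the word metric of $S_i$. Let $\mathcal S_\ell$ be the set of cyclically reduced words of free-product length $\ell$ on the alphabet $\bigcup_i B_i(m)$ (cyclically consecutive letters lie in different factors). A random set of relators $\mathcal R\subset\mathcal S_\ell$ is obtained by choosing $\lfloor|\mathcal S_\ell|^d\rfloor$ words of $\mathcal S_\ell$ uniformly at random, with replacement. A property holds *with overwhelming probability* if its probability tends to $1$ as $\ell\to\infty$. An *abstract diagram* $Y$ is a finite 2-complex with bipartite 1-skeleton (a multigraph whose vertices are called *factor* and *central* vertices), all of whose 2-cells are $2\ell$-gons (attached along closed edge paths of length $2\ell$), with a distinguished factor vertex on the boundary of each 2-cell (the starting point of its boundary path), an orientation of each 2-cell, and a partition of the set of 2-cells. $\mathrm{Area}(Y)$ is the number of 2-cells.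 An *edge triple* $(e_1,v,e_2)$ is an ordered triple in which $e_1\ne e_2$ are edges containing the factor vertex $v$. * $Y$ is *reduced* if there are no two distinct 2-cells in the same part of the partition that share an edge traversed, in the same direction and at the same distance from the distinguished vertex, by both (oriented) boundary paths. * A *connector* is a maximal segment of $Y^{(1)}$ all of whose internal vertices have degree $2$, or a cycle in $Y^{(1)}$ with at most one vertex of degree greater than $2$. $Y$ is *$(K,M)$-bounded* if $\mathrm{Area}(Y)\le K$ and the edges of $Y^{(1)}$ are covered by at most $M$ connectors. * $Y$ *fulfills* $\mathcal R$ if one can assign to each 2-cell a word of $\mathcal R$, the same word to two 2-cells if and only if they lie in the same part, and to each edge triple $(e_1,v,e_2)$ that occurs, in one of the two directions, as a pair of consecutive edges in the boundary path of a 2-cell a *rotation element*, such that: (i) at every factor vertex through which it passes, the boundary path of each 2-cell enters and leaves by two distinct edges, and reading the inverses of the rotation elements along it from the distinguished vertex gives the assigned word; (ii) all rotation elements at a given factor vertex lie in the same $G_i$; (iii) whenever such triples $(e_1,v,e_2),(e_2,v,e_3),\dots,(e_p,v,e_1)$, with $p\ge2$ distinct edges, close up around a factor vertex $v$, the product of their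 rotation elements in this order equals $1$ in $G_*$ (for $p=2$: opposite triples have inverse rotation elements). * A 2-cell *fully* (resp. *partially*) *contains* $(e_1,v,e_2)$ if its boundary contains both (resp. exactly one) of $e_1,e_2$. The *relative degree* $\deg_*(e_1,v,e_2)$ is the number of 2-cells fully containing the triple, plus $1$ if some 2-cell partially contains it. The *relative cancellation* is $$\mathrm{Can}_*(Y)=\frac12\sum_{(e_1,v,e_2)}\bigl(\deg_*(e_1,v,e_2)-1\bigr),$$ the sum being over the edge triples of $Y$ that are fully contained in at least one 2-cell. **Theorem.** For all $K$, $M$ and every $\varepsilon>0$, with overwhelming probability there is no reduced, $(K,M)$-bounded abstract diagram $Y$ that fulfills $\mathcal R$ and satisfies $$\mathrm{Can}_*(Y)>(d+\varepsilon)\,\mathrm{Area}(Y)\,\ell .$$ -/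

import Mathlib

open Filter Topology ProbabilityTheory

namespace FreeProductDensity

section Model

variable {ι : Type*} {G : ι → Type*} [∀ i, Group (G i)]

/-- Nontrivial elements of the ball of radius `m` about `1`, for the word metric of `S`. -/
def ball {H : Type*} [Group H] (S : Set H) (m : ℕ) : Set H :=
  {g | g ≠ 1 ∧ ∃ l : List H, l.length ≤ m ∧ (∀ x ∈ l, x ∈ S ∨ x⁻¹ ∈ S) ∧ l.prod = g}

/-- The set `𝒮_ℓ` of cyclically reduced words of free-product length `ℓ` on the alphabet
`⋃ B_i(m)`: cyclically consecutive syllables lie in different factors (`finRotate ℓ` is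
`k ↦ k + 1` modulo `ℓ`). -/
def words (S : ∀ i, Set (G i)) (m ℓ : ℕ) : Set (Fin ℓ → Σ i, G i) :=
  {w | (∀ k, (w k).2 ∈ ball (S (w k).1) m) ∧ ∀ k, (w k).1 ≠ (w (finRotate ℓ k)).1}

/-- The number `⌊|𝒮_ℓ| ^ d⌋` of relators selected at density `d`. -/
noncomputable def numRelators (S : ∀ i, Set (G i)) (m : ℕ) (d : ℝ) (ℓ : ℕ) : ℕ :=
  ⌊((words S m ℓ).ncard : ℝ) ^ d⌋₊

/-- The outcomes of selecting, with replacement, `⌊|𝒮_ℓ| ^ d⌋` words of `𝒮_ℓ`. -/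
abbrev Sample (S : ∀ i, Set (G i)) (m : ℕ) (d : ℝ) (ℓ : ℕ) : Type _ :=
  Fin (numRelators S m d ℓ) → words S m ℓ

/-- The set `ℛ` of the selected relators. -/
def relators {S : ∀ i, Set (G i)} {m : ℕ} {d : ℝ} {ℓ : ℕ} (ω : Sample S m d ℓ) :
    Set (Fin ℓ → Σ i, G i) :=
  Set.range fun j => (ω j : Fin ℓ → Σ i, G i)

/-- Probability of a property of `ℛ`, the sample being uniformly distributed. -/
noncomputable def prob (S : ∀ i, Set (G i)) (m : ℕ) (d : ℝ) (ℓ : ℕ)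
    (P : Set (Fin ℓ → Σ i, G i) → Prop) : ENNReal :=
  @uniformOn (Sample S m d ℓ) ⊤ Set.univ {ω | P (relators ω)}

/-- `P` (a property of `ℛ`, for each `ℓ`) holds with overwhelming probability. -/
def WithOverwhelmingProbability (S : ∀ i, Set (G i)) (m : ℕ) (d : ℝ)
    (P : ∀ ℓ : ℕ, Set (Fin ℓ → Σ i, G i) → Prop) : Prop :=
  Tendsto (fun ℓ : ℕ => prob S m d ℓ (P ℓ)) atTop (𝓝 1)

end Model

/-- An abstract diagram: a finite 2-complex with bipartite 1-skeleton, all of whose 2-cells are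
`2ℓ`-gons, with a distinguished factor vertex on each 2-cell, an orientation of each 2-cell and a
partition of the set of 2-cells.

The boundary path of the 2-cell `f`, read from its distinguished vertex in the direction of its
orientation, visits the factor vertices number `0, 1, …, ℓ - 1` (the distinguished one is number
`0`). It enters number `k` through the edge `inn f k` and leaves it through `out f k`, so that it
is the closed edge path `out f 0, inn f 1, out f 1, …, inn f (ℓ - 1), out f (ℓ - 1), inn f 0`. -/
structure AbstractDiagram (ℓ : ℕ) where
  /-- factor vertices -/
  FV : Type
  /-- central vertices -/
  CV : Type
  /-- edges -/
  E : Type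
  /-- faces, that is, 2-cells -/
  F : Type
  [fintypeFV : Fintype FV]
  [fintypeCV : Fintype CV]
  [fintypeE : Fintype E]
  [fintypeF : Fintype F]
  /-- the factor vertex of an edge -/
  fv : E → FV
  /-- the central vertex of an edge -/
  cv : E → CV
  inn : F → Fin ℓ → E
  out : F → Fin ℓ → E
  /-- the path enters and leaves the same factor vertex -/
  fv_inn : ∀ f k, fv (inn f k) = fv (out f k)
  /-- the path passes from one factor vertex to the next through one central vertex -/
  cv_out : ∀ f k, cv (out f k) = cv (inn f (finRotate ℓ k))
  /-- the partition of the faces -/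
  part : Setoid F

namespace AbstractDiagram

attribute [instance] fintypeFV fintypeCV fintypeE fintypeF

variable {ℓ : ℕ} (Y : AbstractDiagram ℓ)

def area : ℕ := Fintype.card Y.F

/-- The closed 2-cell `f` contains the edge `e`. -/
def Contains (f : Y.F) (e : Y.E) : Prop := ∃ k, Y.inn f k = e ∨ Y.out f k = e

/-- A reduction pair: two distinct 2-cells in the same part which share an edge that has the same
position in both boundary paths, read from the distinguished vertices along the orientations.
(As the 1-skeleton is bipartite, both paths then traverse that edge in the same direction.) -/
def IsReductionPair (f f' : Y.F) : Prop :=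
  f ≠ f' ∧ Y.part f f' ∧ ∃ k, Y.inn f k = Y.inn f' k ∨ Y.out f k = Y.out f' k

def IsReduced : Prop := ∀ f f', ¬ Y.IsReductionPair f f'

/-- The two edges meet at a vertex of degree 2 of the 1-skeleton. -/
def MeetAtDegreeTwo (e e' : Y.E) : Prop :=
  (Y.fv e = Y.fv e' ∧ {a | Y.fv a = Y.fv e}.ncard = 2) ∨
    (Y.cv e = Y.cv e' ∧ {a | Y.cv a = Y.cv e}.ncard = 2)

/-- Connectors, as sets of edges: two edges are in the same connector if and only if they are
joined by a chain of edges in which consecutive ones meet at a vertex of degree 2. These classes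
are the maximal segments of the 1-skeleton with all internal vertices of degree 2, and the cycles
with at most one vertex of degree greater than 2. -/
def Connector : Type := Quotient (Relation.EqvGen.setoid Y.MeetAtDegreeTwo)

/-- Area at most `K`, and 1-skeleton a union of at most `M` connectors. -/
def IsBounded (K M : ℕ) : Prop := Y.area ≤ K ∧ Nat.card Y.Connector ≤ M

/-- An edge triple `(e₁, v, e₂)`: distinct edges `e₁`, `e₂` with the same factor vertex `v`. -/
abbrev EdgeTriple : Type := {t : Y.E × Y.E // Y.fv t.1 = Y.fv t.2 ∧ t.1 ≠ t.2}

def FullyContains (f : Y.F) (t : Y.EdgeTriple) : Prop :=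
  Y.Contains f t.1.1 ∧ Y.Contains f t.1.2

def PartiallyContains (f : Y.F) (t : Y.EdgeTriple) : Prop :=
  Xor (Y.Contains f t.1.1) (Y.Contains f t.1.2)

open Classical in
/-- The relative degree `deg_*` of an edge triple. -/
noncomputable def relDegree (t : Y.EdgeTriple) : ℕ :=
  Nat.card {f // Y.FullyContains f t} + if ∃ f, Y.PartiallyContains f t then 1 else 0

open Classical in
/-- The relative cancellation `Can_*`. Only edge triples that are fully contained in some 2-cell
contribute. -/
noncomputable def relCancellation : ℝ :=
  (1 / 2) * ∑ t : Y.EdgeTriple with ∃ f, Y.FullyContains f t, ((Y.relDegree t : ℝ) - 1)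

/-- `(e, v, e')` or `(e', v, e)` is passed by the boundary path of some 2-cell. -/
def IsCorner (e e' : Y.E) : Prop :=
  ∃ f k, (Y.inn f k = e ∧ Y.out f k = e') ∨ (Y.inn f k = e' ∧ Y.out f k = e)

variable {ι : Type*} {G : ι → Type*} [∀ i, Group (G i)]

/-- A decoration of `Y` by relators in `R`: a relator for each 2-cell, the same one for two
2-cells if and only if they are in the same part, and a rotation element `rot e e'` for each edge
triple `(e, v, e')` at which a 2-cell has a corner (other values of `rot` play no role), such that
reading the inverses of the rotation elements along each 2-cell gives its relator. -/
structure Decoration (Y : AbstractDiagram ℓ) (R : Set (Fin ℓ → Σ i, G i)) where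
  relator : Y.F → Fin ℓ → Σ i, G i
  relator_mem : ∀ f, relator f ∈ R
  relator_eq_iff : ∀ f f', relator f = relator f' ↔ Y.part f f'
  rot : Y.E → Y.E → Monoid.CoprodI G
  inn_ne_out : ∀ f k, Y.inn f k ≠ Y.out f k
  bears : ∀ f k, (rot (Y.inn f k) (Y.out f k))⁻¹ = Monoid.CoprodI.of (relator f k).2

/-- `Y` fulfills `R`: it has a decoration such that all rotation elements at a factor vertex lie
in the same factor group, and such that, whenever corners of 2-cells close up to a cycle
`(e₀, v, e₁), (e₁, v, e₂), …, (e_{p-1}, v, e₀)` around a factor vertex (with distinct edges), the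
product of their rotation elements is `1` in the free product. For `p = 2` this says that
`(e, v, e')` and `(e', v, e)` have inverse rotation elements. -/
def Fulfills (R : Set (Fin ℓ → Σ i, G i)) : Prop :=
  ∃ D : Decoration Y R,
    (∀ v : Y.FV, ∃ i : ι, ∀ f k, Y.fv (Y.inn f k) = v → (D.relator f k).1 = i) ∧
    ∀ (p : ℕ) (e : Fin p → Y.E), 2 ≤ p → Function.Injective e →
      (∀ j, Y.IsCorner (e j) (e (finRotate p j))) →
      (List.ofFn fun j => D.rot (e j) (e (finRotate p j))).prod = 1

end AbstractDiagram

end FreeProductDensity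

/-! Suppose that two 2-cells pass through the same factor vertex of degree 2. The closing condition
for two edges makes their letters there equal (same direction) or inverse (opposite directions).
Order all letters by the number of the part of their cell, then by position in the word. Among the
cells through such a vertex, every one except the first has its letter forced by an earlier letter:
reducedness excludes ties in the same direction, and ties in opposite directions occur boundedly
often. Relative degrees count cells and not passages, so only the first passage of each cell
matters. Hence `Can_*` is at most the number of forced letters plus a constant Γ depending on K and
M (`IsImmersed.relCancellation_le`).

Number the parts by decreasing size. If `Can_*` exceeds (d+ε)·Area·ℓ, summation by parts gives an N
≤ K such that suitable cells, one in each of the N largest parts, have together at least N((d+ε)ℓ −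
Γ) letters forced by earlier letters of the same N relators (`exists_pattern`).

Along a connector the partner of position k is o + k or o − k with o constant. The identifications
are thus piecewise constant functions with O(M) jumps (`IsImmersed.jumpCount_le`), and there are
only polynomially many patterns in ℓ, although the diagrams are not bounded in number.

For a fixed pattern, the N-tuples of words satisfying it number at most a constant times r to the
number of free letters, where r > 1 is the growth rate of reduced sequences (`card_satisfies_le`).
Letters are not independent, since neighbours lie in different factors; weighting by a Perron
eigenvector makes the count exact up to a constant per change between free and forced positions. On
the other side, 𝒮_ℓ, when nonempty, has at least a constant times r^ℓ elements
(`pow_le_mul_ncard_words`). A union bound over patterns and over the choices of N of the |𝒮_ℓ|^d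
relators gives a probability of order at most poly(ℓ)·r^(−εℓ), which tends to 0 (`density_estimate`,
`ncard_badSamples_le`). -/

namespace FreeProductDensity

/-! ### Counting reduced sequences with forced positions -/

/-- The number of `k < ℓ` such that exactly one of `k`, `k + 1` satisfies `X`. -/
noncomputable def boundaryCount (ℓ : ℕ) (X : ℕ → Prop) : ℕ :=
  {k | k < ℓ ∧ ¬ (X k ↔ X (k + 1))}.ncard

open Classical in
theorem boundaryCount_eq_sum (ℓ : ℕ) (X : ℕ → Prop) :
    boundaryCount ℓ X = ∑ k ∈ Finset.range ℓ, if (X k ↔ X (k + 1)) then 0 else 1 := by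
  have : {k | k < ℓ ∧ ¬ (X k ↔ X (k + 1))} =
      ((Finset.range ℓ).filter fun k => ¬ (X k ↔ X (k + 1)) : Set ℕ) := by ext; simp
  rw [boundaryCount, this, Set.ncard_coe_finset, Finset.card_filter]
  exact Finset.sum_congr rfl fun k _ => by by_cases h : (X k ↔ X (k + 1)) <;> simp [h]

open Classical in
theorem boundaryCount_succ (ℓ : ℕ) (X : ℕ → Prop) :
    boundaryCount (ℓ + 1) X =
      boundaryCount ℓ (fun k => X (k + 1)) + if (X 0 ↔ X 1) then 0 else 1 := by
  rw [boundaryCount_eq_sum, boundaryCount_eq_sum, Finset.sum_range_succ']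

/-- The number of `k < ℓ` that do not satisfy `X`. -/
noncomputable def freeCount (ℓ : ℕ) (X : ℕ → Prop) : ℕ := {k | k < ℓ ∧ ¬ X k}.ncard

open Classical in
theorem freeCount_eq_sum (ℓ : ℕ) (X : ℕ → Prop) :
    freeCount ℓ X = ∑ k ∈ Finset.range ℓ, if X k then 0 else 1 := by
  have : {k | k < ℓ ∧ ¬ X k} = ((Finset.range ℓ).filter fun k => ¬ X k : Set ℕ) := by
    ext; simp
  rw [freeCount, this, Set.ncard_coe_finset, Finset.card_filter]
  exact Finset.sum_congr rfl fun k _ => by by_cases h : X k <;> simp [h]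

open Classical in
theorem freeCount_succ (ℓ : ℕ) (X : ℕ → Prop) :
    freeCount (ℓ + 1) X = freeCount ℓ (fun k => X (k + 1)) + if X 0 then 0 else 1 := by
  rw [freeCount_eq_sum, freeCount_eq_sum, Finset.sum_range_succ']

section ReducedSeq

variable {ι : Type*} {α : ι → Type*}

/-- Consecutive letters lie in different factors, and each letter is allowed. -/
def IsReducedSeq (B : ∀ i, Finset (α i)) {ℓ : ℕ} (w : Fin ℓ → Σ i, α i) : Prop :=
  (∀ k, (w k).2 ∈ B (w k).1) ∧ ∀ k k' : Fin ℓ, (k' : ℕ) = k + 1 → (w k).1 ≠ (w k').1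

theorem IsReducedSeq.tail {B : ∀ i, Finset (α i)} {ℓ : ℕ} {w : Fin (ℓ + 1) → Σ i, α i}
    (hw : IsReducedSeq B w) : IsReducedSeq B (Fin.tail w) :=
  ⟨fun k => hw.1 k.succ, fun k k' h => hw.2 k.succ k'.succ (by simp [h])⟩

theorem IsReducedSeq.cons {B : ∀ i, Finset (α i)} {ℓ : ℕ} {w : Fin ℓ → Σ i, α i}
    (hw : IsReducedSeq B w) {a : Σ i, α i} (ha : a.2 ∈ B a.1)
    (hfirst : ∀ k : Fin ℓ, (k : ℕ) = 0 → (w k).1 ≠ a.1) :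
    IsReducedSeq B (Fin.cons a w : Fin (ℓ + 1) → Σ i, α i) := by
  refine ⟨fun k => ?_, fun k k' h => ?_⟩
  · induction k using Fin.cases with
    | zero => exact ha
    | succ k => exact hw.1 k
  · induction k' using Fin.cases with
    | zero => simp at h
    | succ k' =>
      induction k using Fin.cases with
      | zero => exact (hfirst k' (by simpa using h)).symm
      | succ k => exact hw.2 k k' (by simpa using h)

/-- With two factors only, the factors of the letters alternate. -/
theorem IsReducedSeq.eq_iff_even {B : ∀ i, Finset (α i)} (h2 : ∀ x y z : ι, x ≠ y → y ≠ z → x = z)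
    {ℓ : ℕ} {w : Fin ℓ → Σ i, α i} (hw : IsReducedSeq B w) (h0 : 0 < ℓ) (k : ℕ) (hk : k < ℓ) :
    (w ⟨k, hk⟩).1 = (w ⟨0, h0⟩).1 ↔ Even k := by
  induction k with
  | zero => simp
  | succ k ih =>
    have hne := hw.2 ⟨k, by omega⟩ ⟨k + 1, hk⟩ rfl
    rw [Nat.even_add_one, ← ih (by omega)]
    constructor
    · exact fun h h' => hne (h'.trans h.symm)
    · exact fun h => h2 _ _ _ hne.symm h

end ReducedSeq

section Perron

variable {ι : Type*} [Fintype ι] [DecidableEq ι] {α : ι → Type*}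

/-- The eigenvalue equation says that (q + b i) u i is the same for all i, so u i is proportional to
1/(q + b i), and consistency is φ(q) = ∑ b i/(q + b i) = 1. Since φ(1) > 1 ≥ φ(B) for B = ∑ b i, a
root q > 1 exists. The scaling by q + B puts u between 1 and q + B. -/
theorem exists_perron (b : ι → ℕ) (hb : ∀ i, 1 ≤ b i)
    (hgrow : 1 < ∑ i, (b i : ℝ) / (1 + b i)) :
    ∃ (q : ℝ) (u : ι → ℝ) (C : ℝ), 1 < q ∧ (∀ i, 1 ≤ u i) ∧ (∀ i, u i ≤ C) ∧
      ∀ i, ∑ j with j ≠ i, (b j : ℝ) * u j = q * u i := by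
  have hb' : ∀ i, (1 : ℝ) ≤ b i := fun i => by exact_mod_cast hb i
  have hne : (Finset.univ : Finset ι).Nonempty := by
    by_contra h
    rw [Finset.not_nonempty_iff_eq_empty] at h
    rw [h] at hgrow
    norm_num at hgrow
  obtain ⟨i₀, -⟩ := hne
  set B : ℝ := ∑ i, (b i : ℝ) with hB
  have hbB : ∀ i, (b i : ℝ) ≤ B := fun i =>
    Finset.single_le_sum (f := fun i => (b i : ℝ)) (fun j _ => by positivity) (Finset.mem_univ i)
  have hB1 : 1 ≤ B := (hb' i₀).trans (hbB i₀)
  set φ : ℝ → ℝ := fun x => ∑ i, (b i : ℝ) / (x + b i) with hφ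
  have hcont : ContinuousOn φ (Set.Icc 1 B) := by
    refine continuousOn_finsetSum _ fun i _ => ContinuousOn.div (by fun_prop) (by fun_prop) ?_
    intro x hx
    have := hb' i
    have := hx.1
    positivity
  have hφB : φ B ≤ 1 := by
    calc φ B ≤ ∑ i, (b i : ℝ) / B := by
          refine Finset.sum_le_sum fun i _ => ?_
          have := hb' i
          gcongr
          linarith
      _ = 1 := by rw [← Finset.sum_div, ← hB, div_self (by positivity)]
  obtain ⟨q, hq, hq1⟩ := intermediate_value_Icc' hB1 hcont ⟨hφB, hgrow.le⟩
  have hq0 : 1 < q := by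
    refine lt_of_le_of_ne hq.1 ?_
    rintro rfl
    exact absurd hq1 hgrow.ne'
  refine ⟨q, fun i => (q + B) / (q + b i), q + B, hq0, fun i => ?_, fun i => ?_, fun i => ?_⟩
  · have := hb' i
    have := hbB i
    rw [le_div_iff₀ (by positivity)]
    linarith
  · have := hb' i
    exact div_le_self (by positivity) (by linarith)
  · have h1 : ∑ j, (b j : ℝ) * ((q + B) / (q + b j)) = q + B := by
      calc ∑ j, (b j : ℝ) * ((q + B) / (q + b j)) = (q + B) * φ q := by
            rw [hφ, Finset.mul_sum]
            exact Finset.sum_congr rfl fun j _ => by ring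
        _ = q + B := by rw [hq1, mul_one]
    have h2 := Finset.sum_filter_add_sum_filter_not Finset.univ (fun j => j ≠ i)
      (fun j => (b j : ℝ) * ((q + B) / (q + b j)))
    simp only [ne_eq, not_not, Finset.filter_eq', Finset.mem_univ, if_true,
      Finset.sum_singleton] at h2
    have h3 : (q + b i) ≠ 0 := by have := hb' i; positivity
    have h4 : (q + b i) * ((q + B) / (q + b i)) = q + B := by field_simp
    simp only [ne_eq]
    linear_combination h2 + h1 - h4

theorem sum_sigma_filter_ne (B : ∀ i, Finset (α i)) (i : ι) (x : ι → ℝ) :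
    ∑ a ∈ (Finset.univ.filter (· ≠ i)).sigma B, x a.1 =
      ∑ j with j ≠ i, ((B j).card : ℝ) * x j := by
  rw [Finset.sum_sigma]
  simp

/-- A set of reduced sequences in which each letter at a position in `X` is determined by the
previous letters. -/
theorem card_le_of_determined [∀ i, DecidableEq (α i)] (B : ∀ i, Finset (α i)) {q C : ℝ}
    {u : ι → ℝ}
    (hq : 0 ≤ q) (hu1 : ∀ i, 1 ≤ u i) (huC : ∀ i, u i ≤ C)
    (hPF : ∀ i, ∑ j with j ≠ i, ((B j).card : ℝ) * u j = q * u i) (ℓ : ℕ) :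
    ∀ (W : Finset (Fin ℓ → Σ i, α i)) (X : ℕ → Prop) (i : ι),
      (∀ w ∈ W, IsReducedSeq B w) →
      (∀ w ∈ W, ∀ k : Fin ℓ, (k : ℕ) = 0 → (w k).1 ≠ i) →
      (∀ w ∈ W, ∀ w' ∈ W, ∀ k : Fin ℓ, X k → (∀ k' < k, w k' = w' k') → w k = w' k) →
      (W.card : ℝ) ≤ C ^ boundaryCount ℓ X * q ^ freeCount ℓ X * C ∧
      (¬ X 0 → (W.card : ℝ) ≤ C ^ boundaryCount ℓ X * q ^ freeCount ℓ X * u i) := by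
  classical
  induction ℓ with
  | zero =>
    intro W X i _ _ _
    have hW : (W.card : ℝ) ≤ 1 := by
      exact_mod_cast Finset.card_le_one_of_subsingleton W
    have h1 : boundaryCount 0 X = 0 := by simp [boundaryCount]
    have h2 : freeCount 0 X = 0 := by simp [freeCount]
    have := hu1 i
    have := huC i
    rw [h1, h2]
    constructor
    · simp; linarith
    · intro _; simp; linarith
  | succ ℓ ih =>
    intro W X i hred hfirst hdet
    have hC1 : 1 ≤ C := (hu1 i).trans (huC i)
    set P : ℝ := C ^ boundaryCount ℓ (fun k => X (k + 1)) * q ^ freeCount ℓ (fun k => X (k + 1))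
      with hP
    have hP0 : 0 ≤ P := by positivity
    -- Fix the first letter and delete it: its factor becomes the factor that the next letter must
    -- avoid.
    have key : ∀ a : Σ i, α i, ((W.filter fun w => w 0 = a).card : ℝ) ≤ P * C ∧
        (¬ X 1 → ((W.filter fun w => w 0 = a).card : ℝ) ≤ P * u a.1) := by
      intro a
      have hinj : Set.InjOn (Fin.tail : (Fin (ℓ + 1) → Σ i, α i) → _)
          (W.filter fun w => w 0 = a) := by
        intro w hw w' hw' h
        simp only [Finset.coe_filter, Set.mem_ofPred_eq] at hw hw'
        rw [← Fin.cons_self_tail w, ← Fin.cons_self_tail w', h, hw.2, hw'.2]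
      rw [← Finset.card_image_of_injOn hinj]
      refine ih _ (fun k => X (k + 1)) a.1 ?_ ?_ ?_
      · intro w hw
        simp only [Finset.mem_image, Finset.mem_filter] at hw
        obtain ⟨w, ⟨hw, -⟩, rfl⟩ := hw
        exact (hred w hw).tail
      · intro w hw k hk
        simp only [Finset.mem_image, Finset.mem_filter] at hw
        obtain ⟨w, ⟨hw, rfl⟩, rfl⟩ := hw
        exact ((hred w hw).2 0 k.succ (by simp [hk])).symm
      · intro w hw w' hw' k hk hlt
        simp only [Finset.mem_image, Finset.mem_filter] at hw hw'
        obtain ⟨w, ⟨hw, rfl⟩, rfl⟩ := hw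
        obtain ⟨w', ⟨hw', h'⟩, rfl⟩ := hw'
        refine hdet w hw w' hw' k.succ (by simpa using hk) fun k' hk' => ?_
        induction k' using Fin.cases with
        | zero => exact h'.symm
        | succ k' => exact hlt k' (by simpa using hk')
    rw [boundaryCount_succ, freeCount_succ]
    by_cases hX0 : X 0
    · have hB0 : (W.card : ℝ) ≤ P * C := by
        rcases W.eq_empty_or_nonempty with rfl | ⟨w₀, hw₀⟩
        · have : 0 ≤ P * C := by positivity
          simpa using this
        · have hW : W.filter (fun w => w 0 = w₀ 0) = W :=
            Finset.filter_true_of_mem fun w hw =>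
              hdet w hw w₀ hw₀ 0 (by simpa using hX0) fun k' hk' => absurd hk' (by simp)
          have := (key (w₀ 0)).1
          rw [hW] at this
          exact this
      refine ⟨?_, fun h => absurd hX0 h⟩
      simp only [hX0, if_true, add_zero, true_iff]
      refine hB0.trans ?_
      by_cases hX1 : X 1
      · simp [hX1, hP]
      · simp only [hX1, if_false, pow_succ]
        have : P * C ≤ P * C * C := le_mul_of_one_le_right (by positivity) hC1
        calc P * C ≤ P * C * C := this
          _ = _ := by rw [hP]; ring
    · have hsum : (W.card : ℝ) =
          ∑ a ∈ (Finset.univ.filter (· ≠ i)).sigma B,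
            ((W.filter fun w => w 0 = a).card : ℝ) := by
        rw [Finset.card_eq_sum_card_fiberwise (f := fun w => w 0)
          (t := (Finset.univ.filter (· ≠ i)).sigma B)]
        · push_cast; rfl
        · intro w hw
          simp only [Finset.coe_sigma, Set.mem_sigma_iff, Finset.coe_filter, Finset.mem_univ,
            true_and, Set.mem_ofPred_eq, Finset.mem_coe]
          exact ⟨hfirst w hw 0 rfl, (hred w hw).1 0⟩
      have hmain : (W.card : ℝ) ≤ C ^ (boundaryCount ℓ (fun k => X (k + 1)) +
          if (X 0 ↔ X 1) then 0 else 1) * q ^ (freeCount ℓ (fun k => X (k + 1)) +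
          if X 0 then 0 else 1) * u i := by
        rw [hsum]
        simp only [hX0, if_false, false_iff]
        -- Within a run of free letters the eigenvector equation gives exactly one factor q per
        -- letter. If the next letter is forced, only the bound with C is available for the tail;
        -- this extra C is paid by the boundary at 0.
        by_cases hX1 : X 1
        · simp only [hX1, not_true, if_false]
          calc _ ≤ ∑ a ∈ (Finset.univ.filter (· ≠ i)).sigma B, P * C * u a.1 := by
                refine Finset.sum_le_sum fun a _ => ((key a).1).trans ?_
                exact le_mul_of_one_le_right (by positivity) (hu1 _)
            _ = P * C * (q * u i) := by rw [← Finset.mul_sum, sum_sigma_filter_ne, hPF]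
            _ = _ := by rw [hP]; ring
        · simp only [hX1, not_false_iff, if_true, add_zero]
          calc _ ≤ ∑ a ∈ (Finset.univ.filter (· ≠ i)).sigma B, P * u a.1 :=
                Finset.sum_le_sum fun a _ => (key a).2 hX1
            _ = P * (q * u i) := by rw [← Finset.mul_sum, sum_sigma_filter_ne, hPF]
            _ = _ := by rw [hP]; ring
      exact ⟨hmain.trans (mul_le_mul_of_nonneg_left (huC i) (by positivity)), fun _ => hmain⟩

/-- There are many reduced sequences whose first letter avoids a given factor. -/
theorem exists_many_isReducedSeq [∀ i, DecidableEq (α i)] (B : ∀ i, Finset (α i)) {q C : ℝ}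
    {u : ι → ℝ} (huC : ∀ i, u i ≤ C)
    (hPF : ∀ i, ∑ j with j ≠ i, ((B j).card : ℝ) * u j = q * u i) (ℓ : ℕ) :
    ∀ i, ∃ W : Finset (Fin ℓ → Σ i, α i), (∀ w ∈ W, IsReducedSeq B w) ∧
      (∀ w ∈ W, ∀ k : Fin ℓ, (k : ℕ) = 0 → (w k).1 ≠ i) ∧ q ^ ℓ * u i ≤ C * W.card := by
  induction ℓ with
  | zero =>
    intro i
    refine ⟨{Fin.elim0}, fun w _ => ⟨fun k => k.elim0, fun k => k.elim0⟩,
      fun w _ k => k.elim0, ?_⟩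
    simpa using huC i
  | succ ℓ ih =>
    intro i
    choose W hred hfirst hcard using ih
    let e : (Σ _ : Σ i, α i, Fin ℓ → Σ i, α i) → Fin (ℓ + 1) → Σ i, α i :=
      fun p => Fin.cons p.1 p.2
    have he : Function.Injective e := by
      rintro ⟨a, w⟩ ⟨a', w'⟩ h
      obtain ⟨h1, h2⟩ := Fin.cons_injective2 h
      subst h1 h2
      rfl
    refine ⟨(((Finset.univ.filter (· ≠ i)).sigma B).sigma fun a => W a.1).map ⟨e, he⟩,
      ?_, ?_, ?_⟩
    · intro w hw
      simp only [Finset.mem_map, Finset.mem_sigma, Finset.mem_filter, Finset.mem_univ,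
        true_and, Function.Embedding.coeFn_mk] at hw
      obtain ⟨⟨a, w⟩, ⟨⟨-, ha⟩, hw⟩, rfl⟩ := hw
      exact (hred _ w hw).cons ha (hfirst _ w hw)
    · intro w hw k hk
      simp only [Finset.mem_map, Finset.mem_sigma, Finset.mem_filter, Finset.mem_univ,
        true_and, Function.Embedding.coeFn_mk] at hw
      obtain ⟨⟨a, w⟩, ⟨⟨hi, -⟩, -⟩, rfl⟩ := hw
      obtain rfl : k = 0 := Fin.ext hk
      exact hi
    · rw [Finset.card_map, Finset.card_sigma]
      push_cast
      rw [Finset.mul_sum]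
      calc q ^ (ℓ + 1) * u i = ∑ a ∈ (Finset.univ.filter (· ≠ i)).sigma B, q ^ ℓ * u a.1 := by
            rw [← Finset.mul_sum, sum_sigma_filter_ne, hPF]; ring
        _ ≤ _ := Finset.sum_le_sum fun a _ => hcard a.1

end Perron

/-! ### Combinatorial lemmas: fibres, jumps, classes, summation by parts -/

/-- If each component of the tuples in `W` takes at most `β i` values once the previous components
are given, then `W` has at most `∏ β i` elements. -/
theorem card_le_prod_of_fibers {N : ℕ} {T : Type*} [DecidableEq T] :
    ∀ (W : Finset (Fin N → T)) (β : Fin N → ℝ), (∀ i, 0 ≤ β i) →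
      (∀ (i : Fin N) (w₀ : Fin N → T),
        (((W.filter fun w => ∀ i' < i, w i' = w₀ i').image fun w => w i).card : ℝ) ≤ β i) →
      (W.card : ℝ) ≤ ∏ i, β i := by
  induction N with
  | zero =>
    intro W β _ _
    simpa using Finset.card_le_one_of_subsingleton W
  | succ N ih =>
    intro W β hβ h
    rcases W.eq_empty_or_nonempty with rfl | ⟨w₁, -⟩
    · simpa using Finset.prod_nonneg fun i _ => hβ i
    have hfib : ∀ b : T, ((W.filter fun w => w 0 = b).card : ℝ) ≤ ∏ i : Fin N, β i.succ := by
      intro b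
      have hinj : Set.InjOn (Fin.tail : (Fin (N + 1) → T) → _) (W.filter fun w => w 0 = b) := by
        intro w hw w' hw' h
        simp only [Finset.coe_filter, Set.mem_ofPred_eq] at hw hw'
        rw [← Fin.cons_self_tail w, ← Fin.cons_self_tail w', h, hw.2, hw'.2]
      rw [← Finset.card_image_of_injOn hinj]
      refine ih _ _ (fun i => hβ _) fun i w₀ => ?_
      refine le_trans ?_ (h i.succ (Fin.cons b w₀))
      exact_mod_cast Finset.card_le_card fun x hx => by
        simp only [Finset.mem_image, Finset.mem_filter] at hx ⊢
        obtain ⟨_, ⟨⟨w, ⟨hw, hb⟩, rfl⟩, hlt⟩, rfl⟩ := hx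
        refine ⟨w, ⟨hw, fun i' hi' => ?_⟩, rfl⟩
        induction i' using Fin.cases with
        | zero => exact hb
        | succ i' => exact hlt i' (by simpa using hi')
    have h0 := h 0 w₁
    simp only [Fin.not_lt_zero, false_imp_iff, implies_true, Finset.filter_true] at h0
    have hP : 0 ≤ ∏ i : Fin N, β i.succ := Finset.prod_nonneg fun i _ => hβ _
    calc (W.card : ℝ) = ∑ b ∈ W.image fun w => w 0, ((W.filter fun w => w 0 = b).card : ℝ) := by
          rw [Finset.card_eq_sum_card_image (fun w => w 0) W]; push_cast; rfl
      _ ≤ ∑ b ∈ W.image fun w => w 0, ∏ i : Fin N, β i.succ :=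
          Finset.sum_le_sum fun b _ => hfib b
      _ = (W.image fun w => w 0).card * ∏ i : Fin N, β i.succ := by simp
      _ ≤ β 0 * ∏ i : Fin N, β i.succ := mul_le_mul_of_nonneg_right h0 hP
      _ = ∏ i, β i := (Fin.prod_univ_succ β).symm

/-- The number of `k < ℓ` with `h k ≠ h (k + 1)`. -/
noncomputable def jumpCount {A : Type*} (ℓ : ℕ) (h : ℕ → A) : ℕ :=
  {k | k < ℓ ∧ h k ≠ h (k + 1)}.ncard

/-- Compare with the binomial expansion: the number of i-element subsets is at most s ^ i, hence at
most s ^ i * c.choose i for i ≤ c. -/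
theorem card_finset_le_pow {s c : ℕ} {T : Type*} (A : Finset T) (hA : A.card ≤ s) :
    ((A.powerset).filter fun B => B.card ≤ c).card ≤ (s + 1) ^ c := by
  classical
  have hsub : (A.powerset.filter fun B => B.card ≤ c) ⊆
      (Finset.range (c + 1)).biUnion fun i => A.powersetCard i := by
    intro B hB
    simp only [Finset.mem_filter, Finset.mem_powerset] at hB
    simp only [Finset.mem_biUnion, Finset.mem_range, Finset.mem_powersetCard]
    exact ⟨B.card, by omega, hB.1, rfl⟩
  refine (Finset.card_le_card hsub).trans (Finset.card_biUnion_le.trans ?_)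
  rw [add_pow]
  refine Finset.sum_le_sum fun i hi => ?_
  rw [Finset.card_powersetCard, one_pow, mul_one]
  have h1 : A.card.choose i ≤ s ^ i :=
    (Nat.choose_le_pow A.card i).trans (Nat.pow_le_pow_left hA i)
  exact h1.trans (Nat.le_mul_of_pos_right _ (Nat.choose_pos (by simp at hi; omega)))

/-- There are few functions on `{0, …, ℓ - 1}` with few jumps. -/
theorem finite_and_ncard_le_of_jumpCount {A : Type*} (V : Finset A) (a₀ : A) (ℓ C : ℕ) :
    {h : ℕ → A | (∀ k, ℓ ≤ k → h k = a₀) ∧ (∀ k, h k ∈ V) ∧ jumpCount ℓ h ≤ C}.Finite ∧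
    {h : ℕ → A | (∀ k, ℓ ≤ k → h k = a₀) ∧ (∀ k, h k ∈ V) ∧ jumpCount ℓ h ≤ C}.ncard ≤
      ((ℓ + 1) * V.card + 1) ^ (C + 1) := by
  classical
  set Q := {h : ℕ → A | (∀ k, ℓ ≤ k → h k = a₀) ∧ (∀ k, h k ∈ V) ∧ jumpCount ℓ h ≤ C}
  let J : (ℕ → A) → Finset ℕ := fun h => (Finset.range ℓ).filter fun k => h k ≠ h (k + 1)
  -- A function is recovered from its initial value and from the places and values of its jumps. The
  -- initial value accounts for the + 1 in the exponent.
  let e : (ℕ → A) → Finset (ℕ × A) := fun h =>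
    insert (0, h 0) ((J h).image fun k => (k + 1, h (k + 1)))
  let T := ((Finset.range (ℓ + 1) ×ˢ V).powerset).filter fun B => B.card ≤ C + 1
  have hmaps : ∀ h ∈ Q, e h ∈ (T : Set (Finset (ℕ × A))) := by
    intro h hh
    have hJ : (J h).card ≤ C := by
      have : {k | k < ℓ ∧ h k ≠ h (k + 1)} = (J h : Set ℕ) := by ext; simp [J]
      have h2 := hh.2.2
      rwa [jumpCount, this, Set.ncard_coe_finset] at h2
    simp only [T, Finset.coe_filter, Finset.mem_powerset, Set.mem_ofPred_eq]
    refine ⟨fun x hx => ?_, ?_⟩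
    · simp only [e, J, Finset.mem_insert, Finset.mem_image, Finset.mem_filter,
        Finset.mem_range] at hx
      rw [Finset.mem_product, Finset.mem_range]
      rcases hx with rfl | ⟨k, ⟨hk, -⟩, rfl⟩
      · exact ⟨by simp, hh.2.1 0⟩
      · exact ⟨by simpa using hk, hh.2.1 _⟩
    · refine (Finset.card_insert_le _ _).trans ?_
      exact Nat.succ_le_succ (Finset.card_image_le.trans hJ)
  have hmem : ∀ (h : ℕ → A) k a, (k + 1, a) ∈ e h ↔ (k < ℓ ∧ h k ≠ h (k + 1)) ∧ a = h (k + 1) := by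
    intro h k a
    simp only [e, J, Finset.mem_insert, Finset.mem_image, Finset.mem_filter, Finset.mem_range,
      Prod.mk.injEq]
    constructor
    · rintro (⟨h0, -⟩ | ⟨k', hk', h1, rfl⟩)
      · simp at h0
      · obtain rfl : k' = k := by omega
        exact ⟨hk', rfl⟩
    · rintro ⟨hk, rfl⟩
      exact Or.inr ⟨k, hk, rfl, rfl⟩
  have hmem0 : ∀ (h : ℕ → A) a, (0, a) ∈ e h ↔ a = h 0 := by
    intro h a
    simp [e]
  have hinj : Set.InjOn e Q := by
    intro h hh h' hh' heq
    have : ∀ k, k ≤ ℓ → h k = h' k := by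
      intro k
      induction k with
      | zero =>
        intro _
        exact (hmem0 h' _).1 (heq ▸ (hmem0 h _).2 rfl)
      | succ k ih =>
        intro hk
        have ihk := ih (by omega)
        by_cases h1 : h k = h (k + 1)
        · by_cases h2 : h' k = h' (k + 1)
          · rw [← h1, ← h2, ihk]
          · have := (hmem h k (h' (k + 1))).1 (heq ▸ (hmem h' k _).2 ⟨⟨by omega, h2⟩, rfl⟩)
            exact this.2.symm
        · exact ((hmem h' k (h (k + 1))).1 (heq ▸ (hmem h k _).2 ⟨⟨by omega, h1⟩, rfl⟩)).2
    funext k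
    rcases le_or_gt k ℓ with hk | hk
    · exact this k hk
    · rw [hh.1 k hk.le, hh'.1 k hk.le]
  refine ⟨Set.Finite.of_injOn hmaps hinj T.finite_toSet, ?_⟩
  refine (Set.ncard_le_ncard_of_injOn e hmaps hinj T.finite_toSet).trans ?_
  rw [Set.ncard_coe_finset]
  exact card_finset_le_pow _ (by simp)

/-- A finite set has at most as many elements as there are classes for the equivalence relation
generated by some pairs, plus the number of these pairs. -/
theorem card_le_card_add_card_quotient {E I : Type*} [Fintype E] [Fintype I] (s : Setoid E)
    (a b : I → E) (hgen : ∀ T : Setoid E, (∀ i, T (a i) (b i)) → s ≤ T) :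
    Fintype.card E ≤ Fintype.card I + Nat.card (Quotient s) := by
  classical
  -- Rank–nullity: a function with zero difference on each pair is constant on the classes, so the
  -- kernel has dimension at most the number of classes, while the rank is at most the number of
  -- pairs.
  let T : (E → ℚ) →ₗ[ℚ] (I → ℚ) :=
    { toFun := fun x i => x (a i) - x (b i)
      map_add' := fun x y => by ext i; simp; ring
      map_smul' := fun c x => by ext i; simp; ring }
  let P : (Quotient s → ℚ) →ₗ[ℚ] (E → ℚ) :=
    { toFun := fun x e => x (Quotient.mk s e)
      map_add' := fun x y => rfl
      map_smul' := fun c x => rfl }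
  have hker : LinearMap.ker T ≤ LinearMap.range P := by
    intro x hx
    have hx' : ∀ i, x (a i) = x (b i) := fun i => sub_eq_zero.1 (congrFun hx i)
    have hle := hgen (Setoid.ker x) hx'
    refine ⟨Quotient.lift x fun e e' h => hle h, ?_⟩
    ext e
    rfl
  have h1 := LinearMap.finrank_range_add_finrank_ker T
  have h2 := Submodule.finrank_mono hker
  have h3 := LinearMap.finrank_range_le P
  have h4 := (LinearMap.range T).finrank_le
  simp only [Module.finrank_fintype_fun_eq_card] at h1 h3 h4
  rw [Nat.card_eq_fintype_card]
  omega

/-- Summation by parts: if all prefix sums of x i − a were nonpositive, so would be the sum weighted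
by the decreasing nonnegative m. It passes from an average over cells, where a part counts with its
size, to one over distinct relators. -/
theorem exists_prefix_sum_gt {N : ℕ} (m x : ℕ → ℝ) (a : ℝ) (hm0 : ∀ i, 0 ≤ m i)
    (hm : ∀ i, i + 1 < N → m (i + 1) ≤ m i)
    (h : a * ∑ i ∈ Finset.range N, m i < ∑ i ∈ Finset.range N, m i * x i) :
    ∃ N', 1 ≤ N' ∧ N' ≤ N ∧ N' * a < ∑ i ∈ Finset.range N', x i := by
  by_contra! hcon
  have key : ∀ k, k < N → ∑ i ∈ Finset.range (k + 1), m i * (x i - a) ≤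
      m k * ∑ i ∈ Finset.range (k + 1), (x i - a) := by
    intro k
    induction k with
    | zero => intro _; simp
    | succ k ih =>
      intro hk
      rw [Finset.sum_range_succ, Finset.sum_range_succ _ (k + 1), mul_add]
      have h1 := ih (by omega)
      have h2 := hcon (k + 1) (by omega) (by omega)
      have h3 : ∑ i ∈ Finset.range (k + 1), (x i - a) ≤ 0 := by
        rw [Finset.sum_sub_distrib]; simpa using h2
      have h4 := mul_le_mul_of_nonpos_right (hm k hk) h3
      linarith
  have hfin : ∑ i ∈ Finset.range N, m i * (x i - a) ≤ 0 := by
    rcases N with _ | N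
    · simp
    · refine (key N (by omega)).trans (mul_nonpos_of_nonneg_of_nonpos (hm0 N) ?_)
      have h2 := hcon (N + 1) (by omega) le_rfl
      rw [Finset.sum_sub_distrib]
      simpa using h2
  simp only [mul_sub, Finset.sum_sub_distrib, ← Finset.sum_mul] at hfin
  linarith [mul_comm a (∑ i ∈ Finset.range N, m i)]

theorem exists_option_of_functional {T U : Type*} (r : T → U → Prop)
    (hr : ∀ a b b', r a b → r a b' → b = b') : ∃ h : T → Option U, ∀ a b, h a = some b ↔ r a b := by
  classical
  refine ⟨fun a => if H : ∃ b, r a b then some H.choose else none, fun a b => ?_⟩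
  by_cases H : ∃ b, r a b
  · simp only [H, dif_pos, Option.some.injEq]
    exact ⟨fun h => h ▸ H.choose_spec, fun h => hr _ _ _ H.choose_spec h⟩
  · simp only [H, dif_neg, not_false_iff, reduceCtorEq, false_iff]
    exact fun h => H ⟨b, h⟩

theorem ncard_le_ncard_of_rel {T U : Type*} {A : Set T} {B : Set U} (hB : B.Finite)
    (r : T → U → Prop) (hr : ∀ a ∈ A, ∃ b ∈ B, r a b)
    (hinj : ∀ a ∈ A, ∀ a' ∈ A, ∀ b, r a b → r a' b → a = a') : A.ncard ≤ B.ncard := by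
  classical
  rcases B.eq_empty_or_nonempty with rfl | ⟨b₀, -⟩
  · have : A = ∅ := Set.eq_empty_of_forall_notMem fun a ha => by simpa using hr a ha
    simp [this]
  · let e : T → U := fun a => if h : ∃ b ∈ B, r a b then h.choose else b₀
    have he : ∀ a ∈ A, e a ∈ B ∧ r a (e a) := fun a ha => by
      have h := hr a ha
      simp only [e, h, dif_pos]
      exact h.choose_spec
    exact Set.ncard_le_ncard_of_injOn e (fun a ha => (he a ha).1)
      (fun a ha a' ha' h => hinj a ha a' ha' _ (he a ha).2 (h ▸ (he a' ha').2)) hB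

theorem eq_or_eq_of_ncard_fiber_eq_two {E V : Type*} {φ : E → V} {x y z : E}
    (h : {a | φ a = φ x}.ncard = 2) (hxy : x ≠ y) (hy : φ y = φ x) (hz : φ z = φ x) :
    z = x ∨ z = y := by
  obtain ⟨a, b, -, hs⟩ := Set.ncard_eq_two.1 h
  have h1 : x ∈ {a | φ a = φ x} := rfl
  have h2 : y ∈ {a | φ a = φ x} := hy
  have h3 : z ∈ {a | φ a = φ x} := hz
  rw [hs] at h1 h2 h3
  simp only [Set.mem_insert_iff, Set.mem_singleton_iff] at h1 h2 h3
  grind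

theorem card_add_ncard_fiber_ne_two {E V : Type*} [Fintype E] [Fintype V] (φ : E → V) :
    Fintype.card E = 2 * Nat.card {v : V // {a | φ a = v}.ncard = 2} +
      {e | {a | φ a = φ e}.ncard ≠ 2}.ncard := by
  classical
  have h1 := Set.ncard_add_ncard_compl {e | {a | φ a = φ e}.ncard = 2}
  rw [Nat.card_eq_fintype_card] at h1
  have h2 : {e | {a | φ a = φ e}.ncard = 2}ᶜ = {e | {a | φ a = φ e}.ncard ≠ 2} := rfl
  rw [h2] at h1
  have h3 : {e | {a | φ a = φ e}.ncard = 2}.ncard =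
      2 * Nat.card {v : V // {a | φ a = v}.ncard = 2} := by
    have e1 : {e | {a | φ a = φ e}.ncard = 2} =
        (Finset.univ.filter fun e => {a | φ a = φ e}.ncard = 2 : Set E) := by ext; simp
    rw [e1, Set.ncard_coe_finset, Finset.card_eq_sum_card_fiberwise (f := φ)
      (t := Finset.univ.filter fun v => {a | φ a = v}.ncard = 2)]
    · rw [Finset.sum_congr rfl (g := fun _ => 2), Finset.sum_const, Nat.card_eq_fintype_card,
        Fintype.card_subtype, smul_eq_mul, mul_comm]
      intro v hv
      rw [Finset.mem_filter] at hv
      refine Eq.trans ?_ hv.2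
      rw [← Set.ncard_coe_finset]
      congr 1
      ext e
      simp only [Finset.coe_filter, Finset.mem_filter, Finset.mem_univ, true_and,
        Set.mem_ofPred_eq, and_iff_right_iff_imp]
      rintro rfl
      exact hv.2
    · intro e he
      simpa using he
  omega

/-! ### Identifications as piecewise translations and reflections -/

section Piecewise

/-- The position matched with `k` by a translation or a reflection. -/
def pos (s : Bool) (o k : ℤ) : ℤ := if s then o + k else o - k

/-- Position `k` of the word number `i` is matched by some `h j` with an earlier letter, words being
ordered by their number and letters of a word by their position. -/
def Forced {κ : Type*} (q : κ → ℕ) (h : κ → ℕ → Option (ℤ × Bool)) (i k : ℕ) : Prop :=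
  ∃ j o s, h j k = some (o, s) ∧ (q j < i ∨ q j = i ∧ pos s o k < k)

theorem finite_setOf_lt_and (ℓ : ℕ) (P : ℕ → Prop) : {k | k < ℓ ∧ P k}.Finite :=
  (Set.finite_lt_nat ℓ).subset fun _ h => h.1

theorem ncard_image_le_jumpCount {A : Type*} (ℓ : ℕ) (h : ℕ → A) :
    (h '' {k | k < ℓ}).Finite ∧ (h '' {k | k < ℓ}).ncard ≤ jumpCount ℓ h + 1 := by
  have hfin : (h '' {k | k < ℓ}).Finite := (Set.finite_lt_nat ℓ).image h
  have hJ : {k | k < ℓ ∧ h k ≠ h (k + 1)}.Finite := finite_setOf_lt_and ℓ _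
  refine ⟨hfin, ?_⟩
  have hsub : h '' {k | k < ℓ} ⊆
      insert (h 0) ((fun k => h (k + 1)) '' {k | k < ℓ ∧ h k ≠ h (k + 1)}) := by
    rintro _ ⟨k, hk, rfl⟩
    induction k with
    | zero => exact Set.mem_insert _ _
    | succ k ih =>
      have hk' : k + 1 < ℓ := hk
      by_cases hj : h k = h (k + 1)
      · rw [← hj]; exact ih (show k < ℓ by omega)
      · exact Set.mem_insert_of_mem _ ⟨k, ⟨by omega, hj⟩, rfl⟩
  refine (Set.ncard_le_ncard hsub ((hJ.image _).insert _)).trans ?_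
  refine (Set.ncard_insert_le _ _).trans ?_
  exact Nat.succ_le_succ (Set.ncard_image_le hJ)

/-- The midpoint of a reflection is determined by its offset, and h takes at most one more value
than it has jumps. -/
theorem ncard_reflection_le (ℓ : ℕ) (h : ℕ → Option (ℤ × Bool)) :
    {k : ℕ | k < ℓ ∧ ∃ o : ℤ, h k = some (o, false) ∧ 2 * k ≤ o ∧ o < 2 * k + 2}.ncard ≤
      jumpCount ℓ h + 1 := by
  obtain ⟨hfin, hle⟩ := ncard_image_le_jumpCount ℓ h
  refine le_trans ?_ hle
  refine Set.ncard_le_ncard_of_injOn h (fun k hk => ⟨k, hk.1, rfl⟩) ?_ hfin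
  rintro k ⟨-, o, ho, h1, h2⟩ k' ⟨-, o', ho', h1', h2'⟩ heq
  rw [ho, ho', Option.some.injEq, Prod.mk.injEq] at heq
  omega

/-- Being forced changes between k and k + 1 only where some h j jumps or where k crosses the
midpoint of a reflection. Under a translation, whether the partner comes earlier does not depend on
k. -/
theorem boundaryCount_forced_le {κ : Type*} [Fintype κ] (q : κ → ℕ)
    (h : κ → ℕ → Option (ℤ × Bool)) (i ℓ C : ℕ) (hC : ∀ j, jumpCount ℓ (h j) ≤ C) :
    boundaryCount ℓ (Forced q h i) ≤ Fintype.card κ * (2 * C + 1) := by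
  classical
  let A : κ → Set ℕ := fun j => {k | k < ℓ ∧ h j k ≠ h j (k + 1)} ∪
    {k : ℕ | k < ℓ ∧ ∃ o : ℤ, h j k = some (o, false) ∧ 2 * k ≤ o ∧ o < 2 * k + 2}
  have hAfin : ∀ j, (A j).Finite := fun j =>
    (finite_setOf_lt_and ℓ _).union (finite_setOf_lt_and ℓ _)
  have hA : ∀ j, (A j).ncard ≤ 2 * C + 1 := fun j => by
    refine (Set.ncard_union_le _ _).trans ?_
    have h1 := ncard_reflection_le ℓ (h j)
    have h2 := hC j
    rw [jumpCount] at h1 h2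
    omega
  have hsub : {k | k < ℓ ∧ ¬ (Forced q h i k ↔ Forced q h i (k + 1))} ⊆ ⋃ j, A j := by
    rintro k ⟨hk, hne⟩
    by_contra hcon
    simp only [Set.mem_iUnion, not_exists, A, Set.mem_union, not_or] at hcon
    have hst : ∀ j, h j k = h j (k + 1) := fun j => by
      by_contra hj
      exact (hcon j).1 ⟨hk, hj⟩
    refine hne (exists_congr fun j => exists_congr fun o => exists_congr fun s => ?_)
    rw [← hst j]
    refine and_congr_right fun hs => or_congr_right (and_congr_right fun _ => ?_)
    have h2 := (hcon j).2
    cases s with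
    | true =>
      simp only [pos, if_true]
      push_cast
      omega
    | false =>
      have h3 : ¬ (2 * k ≤ o ∧ o < 2 * k + 2) := fun h3 => h2 ⟨hk, o, hs, h3⟩
      simp only [pos, Bool.false_eq_true, if_false]
      push_cast
      omega
  refine (Set.ncard_le_ncard hsub (Set.finite_iUnion hAfin)).trans ?_
  have h1 := Finset.set_ncard_biUnion_le Finset.univ A
  simp only [Finset.mem_univ, Set.iUnion_true] at h1
  refine h1.trans ((Finset.sum_le_sum fun j _ => hA j).trans ?_)
  simp

end Piecewise

/-! ### Connectors and boundary paths through vertices of degree 2 -/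

namespace AbstractDiagram

variable {ℓ : ℕ} (Y : AbstractDiagram ℓ)

/-- The factor vertex of `e` has degree 2. -/
def DegTwoF (e : Y.E) : Prop := {a | Y.fv a = Y.fv e}.ncard = 2

/-- The central vertex of `e` has degree 2. -/
def DegTwoC (e : Y.E) : Prop := {a | Y.cv a = Y.cv e}.ncard = 2

/-- The edges with an end of degree other than 2. -/
def specialEdges : Set Y.E := {e | ¬ Y.DegTwoF e ∨ ¬ Y.DegTwoC e}

/-- Let p and p' be the numbers of factor and central vertices of degree 2. Joining the two edges at
each of them produces the connectors, so |E| ≤ p + p' + #connectors. Counting edges by either end,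
|E| = 2p + s = 2p' + s', where s and s' count the edges whose factor, resp. central, end has another
degree. Adding up, s + s' ≤ 2 #connectors. -/
theorem ncard_specialEdges_le : Y.specialEdges.ncard ≤ 2 * Nat.card Y.Connector := by
  classical
  let I₁ := {v : Y.FV // {a | Y.fv a = v}.ncard = 2}
  let I₂ := {v : Y.CV // {a | Y.cv a = v}.ncard = 2}
  have h₁ : ∀ v : I₁, ∃ x y, x ≠ y ∧ {a | Y.fv a = v.1} = {x, y} :=
    fun v => Set.ncard_eq_two.1 v.2
  have h₂ : ∀ v : I₂, ∃ x y, x ≠ y ∧ {a | Y.cv a = v.1} = {x, y} :=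
    fun v => Set.ncard_eq_two.1 v.2
  choose a₁ b₁ hab₁ hs₁ using h₁
  choose a₂ b₂ hab₂ hs₂ using h₂
  have hcard := card_le_card_add_card_quotient (I := I₁ ⊕ I₂)
    (Relation.EqvGen.setoid Y.MeetAtDegreeTwo) (Sum.elim a₁ a₂) (Sum.elim b₁ b₂) (by
      intro T hT x y hxy
      induction hxy with
      | rel x y h =>
        rcases h with ⟨hf, h2⟩ | ⟨hf, h2⟩
        · have hx : x ∈ {a | Y.fv a = Y.fv x} := rfl
          have hy : y ∈ {a | Y.fv a = Y.fv x} := hf.symm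
          have hab : T (a₁ ⟨_, h2⟩) (b₁ ⟨_, h2⟩) := hT (Sum.inl ⟨_, h2⟩)
          rw [hs₁ ⟨_, h2⟩] at hx hy
          rcases hx with hx | hx <;> rcases hy with hy | hy <;> rw [hx, hy]
          · exact hab
          · exact T.symm hab
        · have hx : x ∈ {a | Y.cv a = Y.cv x} := rfl
          have hy : y ∈ {a | Y.cv a = Y.cv x} := hf.symm
          have hab : T (a₂ ⟨_, h2⟩) (b₂ ⟨_, h2⟩) := hT (Sum.inr ⟨_, h2⟩)
          rw [hs₂ ⟨_, h2⟩] at hx hy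
          rcases hx with hx | hx <;> rcases hy with hy | hy <;> rw [hx, hy]
          · exact hab
          · exact T.symm hab
      | refl x => exact T.refl _
      | symm x y _ h => exact T.symm h
      | trans x y z _ _ h h' => exact T.trans h h')
  have hF := card_add_ncard_fiber_ne_two Y.fv
  have hC := card_add_ncard_fiber_ne_two Y.cv
  have hU : Y.specialEdges.ncard ≤ {e | {a | Y.fv a = Y.fv e}.ncard ≠ 2}.ncard +
      {e | {a | Y.cv a = Y.cv e}.ncard ≠ 2}.ncard := Set.ncard_union_le _ _
  rw [Fintype.card_sum, ← Nat.card_eq_fintype_card, ← Nat.card_eq_fintype_card (α := I₁),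
    ← Nat.card_eq_fintype_card (α := I₂)] at hcard
  rw [← Nat.card_eq_fintype_card] at hF hC
  change Nat.card Y.E ≤ _ + Nat.card Y.Connector at hcard
  simp only [I₁, I₂] at hcard
  omega

/-- The factor vertex number `k` of the boundary path of `f`. -/
def vtx (f : Y.F) (k : Fin ℓ) : Y.FV := Y.fv (Y.inn f k)

/-- The boundary path of `f` passes at `k`, for the first time, through a factor vertex of
degree 2. -/
def IsFirst (f : Y.F) (k : Fin ℓ) : Prop :=
  Y.DegTwoF (Y.inn f k) ∧ ∀ k' < k, Y.vtx f k' ≠ Y.vtx f k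

theorem IsFirst.eq {Y : AbstractDiagram ℓ} {f : Y.F} {k k' : Fin ℓ} (h : Y.IsFirst f k)
    (h' : Y.IsFirst f k') (hv : Y.vtx f k = Y.vtx f k') : k = k' := by
  rcases lt_trichotomy k k' with hlt | heq | hgt
  · exact absurd hv (h'.2 k hlt)
  · exact heq
  · exact absurd hv.symm (h.2 k' hgt)

theorem exists_isFirst {f : Y.F} {k : Fin ℓ} (h : Y.DegTwoF (Y.inn f k)) :
    ∃ k', Y.IsFirst f k' ∧ Y.vtx f k' = Y.vtx f k := by
  classical
  obtain ⟨k', hk', hmin⟩ := Finset.exists_min_image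
    (Finset.univ.filter fun k' => Y.vtx f k' = Y.vtx f k) id ⟨k, by simp⟩
  simp only [Finset.mem_filter, Finset.mem_univ, true_and, id] at hk' hmin
  refine ⟨k', ⟨?_, fun k'' hlt heq => absurd (hmin k'' (heq.trans hk')) (not_le.2 hlt)⟩, hk'⟩
  unfold DegTwoF at h ⊢
  unfold vtx at hk'
  rwa [hk']

theorem finRotate_eq {k k' : Fin ℓ} (h : (k' : ℕ) = k + 1) : finRotate ℓ k = k' := by
  obtain ⟨k', hk'⟩ := k'
  obtain ⟨k, hk⟩ := k
  simp only at h
  subst h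
  rcases ℓ with _ | ℓ
  · omega
  · exact finRotate_of_lt (by omega)

/-- Boundary paths without backtracking. -/
structure IsImmersed : Prop where
  inn_ne_out : ∀ f k, Y.inn f k ≠ Y.out f k
  vtx_ne : ∀ f k, Y.vtx f k ≠ Y.vtx f (finRotate ℓ k)

variable {Y}

theorem IsImmersed.eq_inn_or_eq_out (hY : Y.IsImmersed) {f : Y.F} {k : Fin ℓ} {e : Y.E}
    (hd : Y.DegTwoF e) (he : Y.vtx f k = Y.fv e) : Y.inn f k = e ∨ Y.out f k = e := by
  have h1 : Y.fv (Y.out f k) = Y.fv (Y.inn f k) := (Y.fv_inn f k).symm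
  have hd' : Y.DegTwoF (Y.inn f k) := by
    unfold DegTwoF at hd ⊢
    unfold vtx at he
    rwa [he]
  rcases eq_or_eq_of_ncard_fiber_eq_two hd' (hY.inn_ne_out f k) h1 he.symm with h | h
  · exact Or.inl h.symm
  · exact Or.inr h.symm

theorem IsImmersed.inn_eq_of_out_eq (hY : Y.IsImmersed) {f : Y.F} {k : Fin ℓ} {a b : Y.E}
    (hd : Y.DegTwoC a) (hab : a ≠ b) (hcv : Y.cv b = Y.cv a) (h : Y.out f k = a) :
    Y.inn f (finRotate ℓ k) = b := by
  subst h
  refine (eq_or_eq_of_ncard_fiber_eq_two hd hab hcv (Y.cv_out f k).symm).resolve_left ?_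
  intro h
  refine hY.vtx_ne f k ?_
  rw [vtx, vtx, h, Y.fv_inn]

theorem IsImmersed.out_eq_of_inn_eq (hY : Y.IsImmersed) {f : Y.F} {k : Fin ℓ} {a b : Y.E}
    (hd : Y.DegTwoC a) (hab : a ≠ b) (hcv : Y.cv b = Y.cv a)
    (h : Y.inn f (finRotate ℓ k) = a) : Y.out f k = b := by
  subst h
  refine (eq_or_eq_of_ncard_fiber_eq_two hd hab hcv (Y.cv_out f k)).resolve_left ?_
  intro h
  refine hY.vtx_ne f k ?_
  rw [vtx, vtx, ← h, Y.fv_inn]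

/-- Distinct edges `a`, `b` with a common central vertex of degree 2 and with distinct factor
vertices of degree 2, at which the boundary path of `f` does not start. -/
structure IsLink (Y : AbstractDiagram ℓ) (f : Y.F) (a b : Y.E) : Prop where
  fv_ne : Y.fv a ≠ Y.fv b
  cv_eq : Y.cv a = Y.cv b
  degC : Y.DegTwoC a
  degF : Y.DegTwoF a
  degF' : Y.DegTwoF b
  base : ∀ k : Fin ℓ, (k : ℕ) = 0 → Y.vtx f k ≠ Y.fv a ∧ Y.vtx f k ≠ Y.fv b

theorem IsLink.ne {f : Y.F} {a b : Y.E} (h : Y.IsLink f a b) : a ≠ b :=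
  fun hab => h.fv_ne (congrArg Y.fv hab)

theorem IsLink.symm {f : Y.F} {a b : Y.E} (h : Y.IsLink f a b) : Y.IsLink f b a :=
  ⟨h.fv_ne.symm, h.cv_eq.symm, by have := h.degC; unfold DegTwoC at *; rwa [← h.cv_eq], h.degF',
    h.degF, fun k hk => (h.base k hk).symm⟩

/-- If the path entered through a at k, it would have met the vertex of b at k − 1, before its first
passage there; k is not 0 because the path does not start on the link. So it leaves through a, and
the next vertex is that of b. -/
theorem IsImmersed.isFirst_link_of_lt (hY : Y.IsImmersed) {f : Y.F} {a b : Y.E}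
    (hl : Y.IsLink f a b) {k k' : Fin ℓ} (hka : Y.vtx f k = Y.fv a)
    (hk' : Y.IsFirst f k') (hkb : Y.vtx f k' = Y.fv b) (hlt : k < k') :
    (k' : ℕ) = k + 1 ∧ Y.out f k = a ∧ Y.inn f k' = b := by
  rcases hY.eq_inn_or_eq_out hl.degF hka with h | h
  · exfalso
    have h0 : (k : ℕ) ≠ 0 := fun h0 => (hl.base k h0).1 hka
    let k₀ : Fin ℓ := ⟨k - 1, by omega⟩
    have hr : finRotate ℓ k₀ = k := finRotate_eq (by simp only [k₀]; omega)
    have hb := hY.out_eq_of_inn_eq (k := k₀) hl.degC hl.ne hl.cv_eq.symm (hr ▸ h)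
    refine hk'.2 k₀ (lt_trans (Fin.lt_def.2 (by simp only [k₀]; omega)) hlt) ?_
    rw [hkb, vtx, Y.fv_inn, hb]
  · have hlt' : (k : ℕ) < k' := hlt
    let k₁ : Fin ℓ := ⟨k + 1, by omega⟩
    have hr : finRotate ℓ k = k₁ := finRotate_eq rfl
    have hb := hY.inn_eq_of_out_eq hl.degC hl.ne hl.cv_eq.symm h
    rw [hr] at hb
    have hle : ¬ k₁ < k' := fun hlt₁ => hk'.2 k₁ hlt₁ (by rw [hkb, vtx, hb])
    have hkk : k' = k₁ := by
      have : ¬ ((k₁ : ℕ) < k') := hle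
      exact Fin.ext (by simp only [k₁] at this ⊢; omega)
    rw [hkk]
    exact ⟨rfl, h, hb⟩

theorem IsImmersed.isFirst_link (hY : Y.IsImmersed) {f : Y.F} {a b : Y.E}
    (hl : Y.IsLink f a b) {k k' : Fin ℓ} (hk : Y.IsFirst f k) (hka : Y.vtx f k = Y.fv a)
    (hk' : Y.IsFirst f k') (hkb : Y.vtx f k' = Y.fv b) :
    ((k' : ℕ) = k + 1 ∧ Y.out f k = a ∧ Y.inn f k' = b) ∨
      ((k : ℕ) = k' + 1 ∧ Y.inn f k = a ∧ Y.out f k' = b) := by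
  rcases lt_trichotomy k k' with hlt | rfl | hgt
  · exact Or.inl (hY.isFirst_link_of_lt hl hka hk' hkb hlt)
  · exact absurd (hka.symm.trans hkb) hl.fv_ne
  · obtain ⟨h1, h2, h3⟩ := hY.isFirst_link_of_lt hl.symm hkb hk hka hgt
    exact Or.inr ⟨h1, h3, h2⟩

theorem IsImmersed.exists_isFirst_of_link (hY : Y.IsImmersed) {f f' : Y.F} {a b : Y.E}
    (hl : Y.IsLink f' a b) {k : Fin ℓ} (hka : Y.vtx f k = Y.fv a) :
    ∃ k', Y.IsFirst f k' ∧ Y.vtx f k' = Y.fv b := by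
  have key : ∃ k', Y.vtx f k' = Y.fv b := by
    rcases hY.eq_inn_or_eq_out hl.degF hka with h | h
    · refine ⟨(finRotate ℓ).symm k, ?_⟩
      have hb := hY.out_eq_of_inn_eq (f := f) (k := (finRotate ℓ).symm k) hl.degC hl.ne
        hl.cv_eq.symm (by rwa [Equiv.apply_symm_apply])
      rw [vtx, Y.fv_inn, hb]
    · exact ⟨finRotate ℓ k, by rw [vtx, hY.inn_eq_of_out_eq hl.degC hl.ne hl.cv_eq.symm h]⟩
  obtain ⟨k', hk'⟩ := key
  have hd : Y.DegTwoF (Y.inn f k') := by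
    have := hl.degF'
    unfold DegTwoF at this ⊢
    rwa [← hk'] at this
  obtain ⟨k'', h1, h2⟩ := Y.exists_isFirst hd
  exact ⟨k'', h1, h2.trans hk'⟩

variable (Y)

/-- `f` and `f'` pass for the first time through the same factor vertex of degree 2 at `k` and
`k'`, where `x` records the translation (same direction) or the reflection (opposite directions)
which maps `k` to `k'`. -/
def Matched (f f' : Y.F) (k : ℕ) (x : ℤ × Bool) : Prop :=
  ∃ (hk : k < ℓ) (k' : Fin ℓ), Y.IsFirst f ⟨k, hk⟩ ∧ Y.IsFirst f' k' ∧
    Y.vtx f' k' = Y.vtx f ⟨k, hk⟩ ∧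
    ((Y.out f ⟨k, hk⟩ = Y.out f' k' ∧ x = ((k' : ℤ) - k, true)) ∨
      (Y.out f ⟨k, hk⟩ ≠ Y.out f' k' ∧ x = ((k' : ℤ) + k, false)))

theorem Matched.functional (f f' : Y.F) (k : ℕ) (x x' : ℤ × Bool) (h : Y.Matched f f' k x)
    (h' : Y.Matched f f' k x') : x = x' := by
  obtain ⟨hk, k', -, h2, h3, h4⟩ := h
  obtain ⟨_, k'', -, h2', h3', h4'⟩ := h'
  obtain rfl : k' = k'' := h2.eq h2' (h3.trans h3'.symm)
  rcases h4 with ⟨h, rfl⟩ | ⟨h, rfl⟩ <;> rcases h4' with ⟨h', rfl⟩ | ⟨h', rfl⟩ <;> tauto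

variable {Y}

/-- Both cells run straight through the link, and neither starts there. As k increases by one, the
partner k' moves by +1 in the same direction and by −1 in the opposite one, so k' − k, respectively
k' + k, is preserved. -/
theorem IsImmersed.matched_succ_iff (hY : Y.IsImmersed) {f f' : Y.F} {k : ℕ} (hk : k + 1 < ℓ)
    (hl : Y.IsLink f (Y.out f ⟨k, by omega⟩) (Y.inn f ⟨k + 1, hk⟩))
    (hl' : Y.IsLink f' (Y.out f ⟨k, by omega⟩) (Y.inn f ⟨k + 1, hk⟩)) (x : ℤ × Bool) :
    Y.Matched f f' k x ↔ Y.Matched f f' (k + 1) x := by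
  have hva : Y.vtx f ⟨k, by omega⟩ = Y.fv (Y.out f ⟨k, by omega⟩) := Y.fv_inn _ _
  have hvb : Y.vtx f ⟨k + 1, hk⟩ = Y.fv (Y.inn f ⟨k + 1, hk⟩) := rfl
  have hother : ∀ {f₁ : Y.F} {k₁ k₂ : Fin ℓ}, Y.inn f k₂ = Y.inn f₁ k₁ →
      Y.DegTwoF (Y.inn f k₂) → Y.out f k₂ = Y.out f₁ k₁ := by
    intro f₁ k₁ k₂ h hd
    rcases hY.eq_inn_or_eq_out (f := f₁) (k := k₁) (e := Y.out f k₂)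
      (by unfold DegTwoF at *; rwa [← Y.fv_inn]) (by rw [vtx, ← h, Y.fv_inn]) with h1 | h1
    · exact absurd (h.trans h1) (hY.inn_ne_out f k₂)
    · exact h1.symm
  constructor
  · rintro ⟨hk0, k', h1, h2, h3, h4⟩
    obtain ⟨κ, hκ1, hκ2⟩ := Y.exists_isFirst (f := f) (k := ⟨k + 1, hk⟩) hl.degF'
    rw [hvb] at hκ2
    rw [hva] at h3
    rcases hY.isFirst_link hl h1 hva hκ1 hκ2 with ⟨e1, e2, e3⟩ | ⟨-, e2, -⟩
    swap
    · exact absurd e2 (hY.inn_ne_out _ _)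
    obtain rfl : κ = ⟨k + 1, hk⟩ := Fin.ext e1
    obtain ⟨κ', hκ1', hκ2'⟩ := hY.exists_isFirst_of_link hl' h3
    refine ⟨hk, κ', hκ1, hκ1', hκ2', ?_⟩
    rcases hY.isFirst_link hl' h2 h3 hκ1' hκ2' with ⟨g1, g2, g3⟩ | ⟨g1, g2, g3⟩
    · left
      refine ⟨hother g3.symm hl.degF', ?_⟩
      rcases h4 with ⟨-, rfl⟩ | ⟨hne, -⟩
      · rw [g1]; push_cast; congr 1; ring
      · exact absurd g2.symm hne
    · right
      refine ⟨fun h => hY.inn_ne_out f ⟨k + 1, hk⟩ (g3.symm.trans h.symm), ?_⟩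
      rcases h4 with ⟨heq, -⟩ | ⟨-, rfl⟩
      · exact absurd (g2.trans heq) (hY.inn_ne_out f' k')
      · rw [g1]; push_cast; congr 1; ring
  · rintro ⟨_, k', h1, h2, h3, h4⟩
    have hk0 : k < ℓ := by omega
    rw [hvb] at h3
    obtain ⟨κ, hκ1, hκ2⟩ := hY.exists_isFirst_of_link hl.symm hvb
    rcases hY.isFirst_link hl hκ1 hκ2 h1 hvb with ⟨e1, e2, e3⟩ | ⟨-, -, e3⟩
    swap
    · exact absurd e3.symm (hY.inn_ne_out _ _)
    obtain rfl : κ = ⟨k, hk0⟩ := Fin.ext (by simpa using e1.symm)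
    obtain ⟨κ', hκ1', hκ2'⟩ := hY.exists_isFirst_of_link hl'.symm h3
    refine ⟨hk0, κ', hκ1, hκ1', hκ2'.trans hva.symm, ?_⟩
    rcases hY.isFirst_link hl' hκ1' hκ2' h2 h3 with ⟨g1, g2, g3⟩ | ⟨g1, g2, g3⟩
    · left
      refine ⟨g2.symm, ?_⟩
      rcases h4 with ⟨-, rfl⟩ | ⟨hne, -⟩
      · rw [g1]; push_cast; congr 1; ring
      · exact absurd (hother g3.symm hl.degF') hne
    · right
      refine ⟨fun h => hY.inn_ne_out f' κ' (g2.trans h), ?_⟩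
      rcases h4 with ⟨heq, -⟩ | ⟨-, rfl⟩
      · exact absurd (g3.symm.trans heq.symm) (hY.inn_ne_out f _)
      · rw [g1]; push_cast; congr 1; ring

/-- The edges at which a matching of `f` with `f'` may be interrupted. -/
def breakEdges (Y : AbstractDiagram ℓ) (f f' : Y.F) : Set Y.E :=
  Y.specialEdges ∪ ({e | Y.DegTwoF e ∧ ∃ k : Fin ℓ, (k : ℕ) = 0 ∧ Y.vtx f k = Y.fv e} ∪
    {e | Y.DegTwoF e ∧ ∃ k : Fin ℓ, (k : ℕ) = 0 ∧ Y.vtx f' k = Y.fv e})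

/-- Besides the special edges, each of the two cells contributes at most the two edges at its
distinguished vertex. -/
theorem ncard_breakEdges_le (f f' : Y.F) :
    (Y.breakEdges f f').ncard ≤ 2 * Nat.card Y.Connector + 4 := by
  have key : ∀ f : Y.F,
      {e | Y.DegTwoF e ∧ ∃ k : Fin ℓ, (k : ℕ) = 0 ∧ Y.vtx f k = Y.fv e}.ncard ≤ 2 := by
    intro f
    rcases Set.eq_empty_or_nonempty
      {e | Y.DegTwoF e ∧ ∃ k : Fin ℓ, (k : ℕ) = 0 ∧ Y.vtx f k = Y.fv e} with h | ⟨e, he, k, hk, hv⟩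
    · rw [h]; simp
    · rw [← show _ = 2 from he]
      refine Set.ncard_le_ncard ?_ (Set.toFinite _)
      rintro e' ⟨-, k', hk', hv'⟩
      obtain rfl : k = k' := Fin.ext (hk.trans hk'.symm)
      exact hv'.symm.trans hv
  have h1 := Set.ncard_union_le Y.specialEdges
    ({e | Y.DegTwoF e ∧ ∃ k : Fin ℓ, (k : ℕ) = 0 ∧ Y.vtx f k = Y.fv e} ∪
    {e | Y.DegTwoF e ∧ ∃ k : Fin ℓ, (k : ℕ) = 0 ∧ Y.vtx f' k = Y.fv e})
  have h2 := Set.ncard_union_le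
    {e | Y.DegTwoF e ∧ ∃ k : Fin ℓ, (k : ℕ) = 0 ∧ Y.vtx f k = Y.fv e}
    {e | Y.DegTwoF e ∧ ∃ k : Fin ℓ, (k : ℕ) = 0 ∧ Y.vtx f' k = Y.fv e}
  have h3 := Y.ncard_specialEdges_le
  have h4 := key f
  have h5 := key f'
  rw [breakEdges]
  omega

theorem IsImmersed.isLink_of_notMem (hY : Y.IsImmersed) {f f' : Y.F} {k : ℕ} (hk : k + 1 < ℓ)
    (ha : Y.out f ⟨k, by omega⟩ ∉ Y.breakEdges f f')
    (hb : Y.inn f ⟨k + 1, hk⟩ ∉ Y.breakEdges f f') :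
    Y.IsLink f (Y.out f ⟨k, by omega⟩) (Y.inn f ⟨k + 1, hk⟩) ∧
      Y.IsLink f' (Y.out f ⟨k, by omega⟩) (Y.inn f ⟨k + 1, hk⟩) := by
  simp only [breakEdges, specialEdges, Set.mem_union, Set.mem_ofPred_eq, not_or, not_not,
    not_and, not_exists] at ha hb
  obtain ⟨⟨a1, a2⟩, a3, a4⟩ := ha
  obtain ⟨⟨b1, b2⟩, b3, b4⟩ := hb
  have hr : finRotate ℓ ⟨k, by omega⟩ = ⟨k + 1, hk⟩ := finRotate_eq rfl
  have hne : Y.fv (Y.out f ⟨k, by omega⟩) ≠ Y.fv (Y.inn f ⟨k + 1, hk⟩) := by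
    have := hY.vtx_ne f ⟨k, by omega⟩
    rwa [hr, vtx, vtx, Y.fv_inn] at this
  have hcv : Y.cv (Y.out f ⟨k, by omega⟩) = Y.cv (Y.inn f ⟨k + 1, hk⟩) := by
    rw [Y.cv_out, hr]
  exact ⟨⟨hne, hcv, a2, a1, b1, fun k hk => ⟨a3 a1 k hk, b3 b1 k hk⟩⟩,
    ⟨hne, hcv, a2, a1, b1, fun k hk => ⟨a4 a1 k hk, b4 b1 k hk⟩⟩⟩

theorem IsImmersed.jumpCount_le (hY : Y.IsImmersed) {f f' : Y.F} {h : ℕ → Option (ℤ × Bool)}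
    (hh : ∀ k x, h k = some x ↔ Y.Matched f f' k x) :
    jumpCount ℓ h ≤ 8 * Nat.card Y.Connector + 17 := by
  set T := Y.breakEdges f f' with hT
  have hTfin : T.Finite := Set.toFinite _
  -- First passages next to a break edge. Each set injects into T: in S₁ and S₃ the break edge lies
  -- at the vertex of the first passage and determines it; in S₂ and S₄ it lies one step further,
  -- and the central vertex of degree 2 recovers the edge at the first passage.
  let S₁ : Set ℕ := {k | ∃ hk : k < ℓ, Y.IsFirst f ⟨k, hk⟩ ∧ Y.out f ⟨k, hk⟩ ∈ T}
  let S₂ : Set ℕ := {k | ∃ hk : k + 1 < ℓ, Y.IsFirst f ⟨k, by omega⟩ ∧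
    Y.inn f ⟨k + 1, hk⟩ ∈ T ∧ Y.DegTwoC (Y.inn f ⟨k + 1, hk⟩)}
  let S₃ : Set ℕ := {k | ∃ hk : k + 1 < ℓ, Y.IsFirst f ⟨k + 1, hk⟩ ∧ Y.inn f ⟨k + 1, hk⟩ ∈ T}
  let S₄ : Set ℕ := {k | ∃ hk : k + 1 < ℓ, Y.IsFirst f ⟨k + 1, hk⟩ ∧
    Y.out f ⟨k, by omega⟩ ∈ T ∧ Y.DegTwoC (Y.out f ⟨k, by omega⟩)}
  have hrot : ∀ (k : ℕ) (hk : k + 1 < ℓ), finRotate ℓ ⟨k, by omega⟩ = ⟨k + 1, hk⟩ :=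
    fun k hk => finRotate_eq rfl
  have hab : ∀ (k : ℕ) (hk : k + 1 < ℓ), Y.out f ⟨k, by omega⟩ ≠ Y.inn f ⟨k + 1, hk⟩ := by
    intro k hk he
    have := hY.vtx_ne f ⟨k, by omega⟩
    rw [hrot k hk, vtx, vtx, ← he, Y.fv_inn] at this
    exact this rfl
  have hcv : ∀ (k : ℕ) (hk : k + 1 < ℓ),
      Y.cv (Y.out f ⟨k, by omega⟩) = Y.cv (Y.inn f ⟨k + 1, hk⟩) := by
    intro k hk
    rw [Y.cv_out, hrot k hk]
  have hout : ∀ {k₁ k₂ : Fin ℓ}, Y.IsFirst f k₁ → Y.IsFirst f k₂ → Y.out f k₁ = Y.out f k₂ →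
      k₁ = k₂ := by
    intro k₁ k₂ h1 h2 he
    exact h1.eq h2 (by rw [vtx, vtx, Y.fv_inn, Y.fv_inn, he])
  have hinn : ∀ {k₁ k₂ : Fin ℓ}, Y.IsFirst f k₁ → Y.IsFirst f k₂ → Y.inn f k₁ = Y.inn f k₂ →
      k₁ = k₂ := by
    intro k₁ k₂ h1 h2 he
    exact h1.eq h2 (by rw [vtx, vtx, he])
  have b₁ : S₁.ncard ≤ T.ncard := by
    refine ncard_le_ncard_of_rel hTfin
      (fun k e => ∃ hk : k < ℓ, Y.IsFirst f ⟨k, hk⟩ ∧ Y.out f ⟨k, hk⟩ = e) ?_ ?_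
    · rintro k ⟨hk, h1, h2⟩
      exact ⟨_, h2, hk, h1, rfl⟩
    · rintro k - k' - e ⟨hk, h1, h2⟩ ⟨hk', h1', h2'⟩
      exact Fin.mk.inj_iff.1 (hout h1 h1' (h2.trans h2'.symm))
  have b₃ : S₃.ncard ≤ T.ncard := by
    refine ncard_le_ncard_of_rel hTfin
      (fun k e => ∃ hk : k + 1 < ℓ, Y.IsFirst f ⟨k + 1, hk⟩ ∧ Y.inn f ⟨k + 1, hk⟩ = e) ?_ ?_
    · rintro k ⟨hk, h1, h2⟩
      exact ⟨_, h2, hk, h1, rfl⟩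
    · rintro k - k' - e ⟨hk, h1, h2⟩ ⟨hk', h1', h2'⟩
      simpa using hinn h1 h1' (h2.trans h2'.symm)
  have b₂ : S₂.ncard ≤ T.ncard := by
    refine ncard_le_ncard_of_rel hTfin
      (fun k e => ∃ hk : k + 1 < ℓ, Y.IsFirst f ⟨k, by omega⟩ ∧ Y.inn f ⟨k + 1, hk⟩ = e ∧
        Y.DegTwoC e) ?_ ?_
    · rintro k ⟨hk, h1, h2, h3⟩
      exact ⟨_, h2, hk, h1, rfl, h3⟩
    · rintro k - k' - e ⟨hk, h1, h2, h3⟩ ⟨hk', h1', h2', -⟩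
      subst h2
      have := hY.out_eq_of_inn_eq (f := f) (k := ⟨k', by omega⟩) h3 (hab k hk).symm (hcv k hk)
        (by rw [hrot k' hk', h2'])
      simpa using hout h1 h1' this.symm
  have b₄ : S₄.ncard ≤ T.ncard := by
    refine ncard_le_ncard_of_rel hTfin
      (fun k e => ∃ hk : k + 1 < ℓ, Y.IsFirst f ⟨k + 1, hk⟩ ∧ Y.out f ⟨k, by omega⟩ = e ∧
        Y.DegTwoC e) ?_ ?_
    · rintro k ⟨hk, h1, h2, h3⟩
      exact ⟨_, h2, hk, h1, rfl, h3⟩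
    · rintro k - k' - e ⟨hk, h1, h2, h3⟩ ⟨hk', h1', h2', -⟩
      subst h2
      have := hY.inn_eq_of_out_eq (f := f) (k := ⟨k', by omega⟩) h3 (hab k hk) (hcv k hk).symm h2'
      rw [hrot k' hk'] at this
      simpa using hinn h1 h1' this.symm
  -- Since h vanishes from ℓ on, ℓ − 1 may be a jump regardless of the edges. Elsewhere, if a break
  -- edge lies between k and k + 1 and k is in no Sᵢ, neither position is a first passage, so both
  -- values are `none`; without break edge, `matched_succ_iff` applies.
  have hsub : {k | k < ℓ ∧ h k ≠ h (k + 1)} ⊆ {ℓ - 1} ∪ ((S₁ ∪ S₂) ∪ (S₃ ∪ S₄)) := by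
    rintro k ⟨hk, hne⟩
    by_contra hcon
    simp only [Set.mem_union, not_or, Set.mem_singleton_iff] at hcon
    obtain ⟨h0, ⟨h1, h2⟩, h3, h4⟩ := hcon
    have hk1 : k + 1 < ℓ := by omega
    refine hne (Option.ext fun x => ?_)
    rw [hh, hh]
    by_cases ha : Y.out f ⟨k, by omega⟩ ∈ T <;> by_cases hb : Y.inn f ⟨k + 1, hk1⟩ ∈ T
    · exact ⟨fun ⟨_, _, hf, _⟩ => absurd ⟨hk, hf, ha⟩ h1, fun ⟨_, _, hf, _⟩ =>
        absurd ⟨hk1, hf, hb⟩ h3⟩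
    · have hd : Y.DegTwoC (Y.out f ⟨k, by omega⟩) := by
        have : Y.DegTwoC (Y.inn f ⟨k + 1, hk1⟩) := by
          by_contra hd
          exact hb (Or.inl (Or.inr hd))
        unfold DegTwoC at this ⊢
        rwa [hcv k hk1]
      exact ⟨fun ⟨_, _, hf, _⟩ => absurd ⟨hk, hf, ha⟩ h1, fun ⟨_, _, hf, _⟩ =>
        absurd ⟨hk1, hf, ha, hd⟩ h4⟩
    · have hd : Y.DegTwoC (Y.inn f ⟨k + 1, hk1⟩) := by
        have : Y.DegTwoC (Y.out f ⟨k, by omega⟩) := by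
          by_contra hd
          exact ha (Or.inl (Or.inr hd))
        unfold DegTwoC at this ⊢
        rwa [← hcv k hk1]
      exact ⟨fun ⟨_, _, hf, _⟩ => absurd ⟨hk1, hf, hb, hd⟩ h2, fun ⟨_, _, hf, _⟩ =>
        absurd ⟨hk1, hf, hb⟩ h3⟩
    · obtain ⟨hl, hl'⟩ := hY.isLink_of_notMem hk1 ha hb
      exact hY.matched_succ_iff hk1 hl hl' x
  have hfin : ({ℓ - 1} ∪ ((S₁ ∪ S₂) ∪ (S₃ ∪ S₄))).Finite := by
    refine (Set.finite_lt_nat (ℓ + 1)).subset ?_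
    intro k hk
    simp only [Set.mem_union, Set.mem_singleton_iff] at hk
    have : k < ℓ + 1 := by
      rcases hk with rfl | (⟨hk, -⟩ | ⟨hk, -⟩) | (⟨hk, -⟩ | ⟨hk, -⟩) <;> omega
    exact this
  have c0 := Set.ncard_le_ncard hsub hfin
  have c1 := Set.ncard_union_le {ℓ - 1} ((S₁ ∪ S₂) ∪ (S₃ ∪ S₄))
  have c2 := Set.ncard_union_le (S₁ ∪ S₂) (S₃ ∪ S₄)
  have c3 := Set.ncard_union_le S₁ S₂
  have c4 := Set.ncard_union_le S₃ S₄
  have c5 : T.ncard ≤ 2 * Nat.card Y.Connector + 4 := ncard_breakEdges_le f f'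
  rw [Set.ncard_singleton] at c1
  rw [jumpCount]
  omega

end AbstractDiagram
-- Codes for matchings, and their effect on the relators
/-- The number of `k < ℓ` that satisfy `X`. -/
noncomputable def forcedCount (ℓ : ℕ) (X : ℕ → Prop) : ℕ := {k | k < ℓ ∧ X k}.ncard

theorem forcedCount_add_freeCount (ℓ : ℕ) (X : ℕ → Prop) :
    forcedCount ℓ X + freeCount ℓ X = ℓ := by
  rw [forcedCount, freeCount, ← Set.ncard_union_eq _ (finite_setOf_lt_and ℓ _)
    (finite_setOf_lt_and ℓ _)]
  · have : {k | k < ℓ ∧ X k} ∪ {k | k < ℓ ∧ ¬ X k} = (Finset.range ℓ : Set ℕ) := by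
      ext k
      simp only [Set.mem_union, Set.mem_ofPred_eq, Finset.coe_range, Set.mem_Iio]
      tauto
    rw [this, Set.ncard_coe_finset, Finset.card_range]
  · rw [Set.disjoint_left]
    rintro k ⟨-, h⟩ ⟨-, h'⟩
    exact h' h

theorem exists_equiv_antitone {Q : Type*} [Fintype Q] (c : Q → ℕ) :
    ∃ e : Q ≃ Fin (Fintype.card Q), ∀ i j, i ≤ j → c (e.symm j) ≤ c (e.symm i) := by
  let e₀ := Fintype.equivFin Q
  let φ : Fin (Fintype.card Q) → ℕᵒᵈ := fun i => OrderDual.toDual (c (e₀.symm i))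
  refine ⟨e₀.trans (Tuple.sort φ).symm, fun i j hij => ?_⟩
  exact Tuple.monotone_sort φ hij

section Letters

variable {ι : Type*} {G : ι → Type*} [∀ i, Group (G i)]

/-- A letter or its inverse. -/
def act (s : Bool) (a : Σ i, G i) : Σ i, G i := if s then a else ⟨a.1, a.2⁻¹⟩

theorem letter_ext {a b : Σ i, G i} (h1 : a.1 = b.1)
    (h2 : (Monoid.CoprodI.of a.2 : Monoid.CoprodI G) = Monoid.CoprodI.of b.2) : a = b := by
  classical
  obtain ⟨i, x⟩ := a
  obtain ⟨j, y⟩ := b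
  obtain rfl : i = j := h1
  exact congrArg (Sigma.mk i) (Monoid.CoprodI.of_injective i h2)

/-- The words `w i` satisfy the identifications of letters described by `h`. -/
def Satisfies {N K ℓ : ℕ} (q : Fin K → ℕ) (h : Fin N → Fin K → ℕ → Option (ℤ × Bool))
    (w : Fin N → Fin ℓ → Σ i, G i) : Prop :=
  ∀ (i : Fin N) (j : Fin K) (k : Fin ℓ) (o : ℤ) (s : Bool), h i j k = some (o, s) →
    (q j < i ∨ q j = i ∧ pos s o (k : ℕ) < (k : ℕ)) →
    ∃ (i' : Fin N) (k' : Fin ℓ), (i' : ℕ) = q j ∧ ((k' : ℕ) : ℤ) = pos s o (k : ℕ) ∧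
      w i k = act s (w i' k')

end Letters

/-- The values of matchings of words of length `ℓ`. -/
noncomputable def codeValues (ℓ : ℕ) : Finset (Option (ℤ × Bool)) :=
  Finset.insertNone (Finset.Icc (-(ℓ : ℤ)) (2 * ℓ) ×ˢ Finset.univ)

theorem card_codeValues (ℓ : ℕ) : (codeValues ℓ).card = 6 * ℓ + 3 := by
  rw [codeValues, Finset.card_insertNone, Finset.card_product, Int.card_Icc, Finset.card_univ,
    Fintype.card_bool]
  omega

/-- The piecewise constant functions that describe matchings of words of length `ℓ`. -/
def codes (ℓ C : ℕ) : Set (ℕ → Option (ℤ × Bool)) :=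
  {h | (∀ k, ℓ ≤ k → h k = none) ∧ (∀ k, h k ∈ codeValues ℓ) ∧ jumpCount ℓ h ≤ C}

namespace AbstractDiagram

variable {ℓ : ℕ} {Y : AbstractDiagram ℓ}

theorem Matched.bounds {f f' : Y.F} {k : ℕ} {x : ℤ × Bool} (h : Y.Matched f f' k x) :
    x.1 ∈ Finset.Icc (-(ℓ : ℤ)) (2 * ℓ) := by
  obtain ⟨hk, k', -, -, -, h4⟩ := h
  have hk' := k'.2
  rw [Finset.mem_Icc]
  rcases h4 with ⟨-, rfl⟩ | ⟨-, rfl⟩ <;> constructor <;> simp only <;> omega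

theorem IsImmersed.mem_codes (hY : Y.IsImmersed) {f f' : Y.F} {h : ℕ → Option (ℤ × Bool)}
    (hh : ∀ k x, h k = some x ↔ Y.Matched f f' k x) {M : ℕ} (hM : Nat.card Y.Connector ≤ M) :
    h ∈ codes ℓ (8 * M + 17) := by
  refine ⟨fun k hk => ?_, fun k => ?_, ?_⟩
  · rw [Option.eq_none_iff_forall_ne_some]
    intro x hx
    obtain ⟨hk', -⟩ := (hh k x).1 hx
    omega
  · rw [codeValues, Finset.mem_insertNone]
    intro x hx
    rw [Finset.mem_product]
    exact ⟨((hh k x).1 hx).bounds, Finset.mem_univ _⟩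
  · have := hY.jumpCount_le hh
    omega

section Decorated

variable {ι : Type*} {G : ι → Type*} [∀ i, Group (G i)] {R : Set (Fin ℓ → Σ i, G i)}

/-- A path turning back at a central vertex would return to the same factor vertex, giving two
cyclically consecutive letters in one factor. -/
theorem Decoration.isImmersed (D : Decoration Y R)
    (hR : ∀ w ∈ R, ∀ k, (w k).1 ≠ (w (finRotate ℓ k)).1)
    (hfac : ∀ v : Y.FV, ∃ i : ι, ∀ f k, Y.fv (Y.inn f k) = v → (D.relator f k).1 = i) :
    Y.IsImmersed := by
  refine ⟨D.inn_ne_out, fun f k hv => hR _ (D.relator_mem f) k ?_⟩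
  obtain ⟨i, hi⟩ := hfac (Y.vtx f k)
  rw [hi f k rfl, hi f _ hv.symm]

theorem Decoration.relator_eq_act (D : Decoration Y R)
    (hfac : ∀ v : Y.FV, ∃ i : ι, ∀ f k, Y.fv (Y.inn f k) = v → (D.relator f k).1 = i)
    (hclose : ∀ (p : ℕ) (e : Fin p → Y.E), 2 ≤ p → Function.Injective e →
      (∀ j, Y.IsCorner (e j) (e (finRotate p j))) →
      (List.ofFn fun j => D.rot (e j) (e (finRotate p j))).prod = 1)
    (hY : Y.IsImmersed) {f f' : Y.F} {k : Fin ℓ} {o : ℤ} {s : Bool}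
    (h : Y.Matched f f' k (o, s)) :
    ∃ k' : Fin ℓ, ((k' : ℕ) : ℤ) = pos s o (k : ℕ) ∧ D.relator f k = act s (D.relator f' k') := by
  obtain ⟨hk, k', h1, h2, h3, h4⟩ := h
  simp only [Fin.eta] at h1 h3 h4
  obtain ⟨i, hi⟩ := hfac (Y.vtx f k)
  have hsame : (D.relator f k).1 = (D.relator f' k').1 := (hi f k rfl).trans (hi f' k' h3).symm
  have hd : Y.DegTwoF (Y.out f' k') := by
    have := h2.1
    unfold DegTwoF at this ⊢
    rwa [← Y.fv_inn]
  have hv : Y.vtx f k = Y.fv (Y.out f' k') := by rw [← h3, vtx, Y.fv_inn]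
  refine ⟨k', ?_, ?_⟩
  · rcases h4 with ⟨-, hx⟩ | ⟨-, hx⟩ <;> rw [Prod.mk.injEq] at hx <;> obtain ⟨rfl, rfl⟩ := hx <;>
      simp [pos]
  · have b1 := D.bears f k
    have b2 := D.bears f' k'
    rcases h4 with ⟨hout, hx⟩ | ⟨hout, hx⟩ <;> rw [Prod.mk.injEq] at hx <;> obtain ⟨-, rfl⟩ := hx
    · have hinn : Y.inn f k = Y.inn f' k' := by
        rcases hY.eq_inn_or_eq_out h2.1 h3.symm with h | h
        · exact h
        · exact absurd (h.symm.trans hout) (hY.inn_ne_out f' k')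
      rw [hinn, hout] at b1
      exact letter_ext hsame (b1.symm.trans b2)
    · have e1 : Y.inn f k = Y.out f' k' := (hY.eq_inn_or_eq_out hd hv).resolve_right hout
      have e2 : Y.out f k = Y.inn f' k' := by
        rcases hY.eq_inn_or_eq_out h2.1 h3.symm with h | h
        · exact absurd (h.symm.trans e1) (hY.inn_ne_out f' k')
        · exact h
      -- Opposite directions: this is the only use of the closing condition, and only for p = 2.
      have hp := hclose 2 ![Y.inn f k, Y.out f k] le_rfl
        (by
          intro a b hab
          have := hY.inn_ne_out f k
          fin_cases a <;> fin_cases b <;> simp_all)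
        (by
          intro j
          fin_cases j
          · exact ⟨f, k, Or.inl ⟨rfl, rfl⟩⟩
          · exact ⟨f, k, Or.inr ⟨rfl, rfl⟩⟩)
      have hp' : D.rot (Y.inn f k) (Y.out f k) * D.rot (Y.out f k) (Y.inn f k) = 1 := by
        simpa [List.ofFn_succ] using hp
      rw [e1, e2] at b1 hp'
      refine letter_ext hsame ?_
      change _ = Monoid.CoprodI.of (D.relator f' k').2⁻¹
      rw [map_inv, ← b1, ← b2, inv_inv]
      exact inv_eq_of_mul_eq_one_right hp'

end Decorated

open Classical in
/-- Each value of `k` accounts for at most two edge triples. -/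
theorem IsImmersed.card_edgeTriple_le (hY : Y.IsImmersed) (f : Y.F) (P : ℕ → Prop) :
    (Finset.univ.filter fun t : Y.EdgeTriple =>
      ∃ k : Fin ℓ, Y.IsFirst f k ∧ Y.vtx f k = Y.fv t.1.1 ∧ P k).card ≤
      2 * {k | k < ℓ ∧ P k}.ncard := by
  have hfin : ({k | k < ℓ ∧ P k} ×ˢ (Set.univ : Set Bool)).Finite :=
    (finite_setOf_lt_and ℓ P).prod Set.finite_univ
  rw [← Set.ncard_coe_finset]
  have hr : 2 * {k | k < ℓ ∧ P k}.ncard = ({k | k < ℓ ∧ P k} ×ˢ (Set.univ : Set Bool)).ncard := by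
    rw [Set.ncard_prod, Set.ncard_univ, Nat.card_eq_fintype_card, Fintype.card_bool, mul_comm]
  rw [hr]
  -- A first passage determines its vertex of degree 2, where there are two ordered triples; the
  -- Boolean tells which edge comes first.
  refine ncard_le_ncard_of_rel hfin
    (fun t x => ∃ k : Fin ℓ, Y.IsFirst f k ∧ Y.vtx f k = Y.fv t.1.1 ∧ (k : ℕ) = x.1 ∧
      (x.2 = true ↔ Y.inn f k = t.1.1)) ?_ ?_
  · intro t ht
    simp only [Finset.coe_filter, Finset.mem_univ, true_and, Set.mem_ofPred_eq] at ht
    obtain ⟨k, h1, h2, h3⟩ := ht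
    exact ⟨(k, decide (Y.inn f k = t.1.1)), ⟨⟨k.2, h3⟩, Set.mem_univ _⟩, k, h1, h2, rfl, by simp⟩
  · rintro t - t' - x ⟨k, h1, h2, h3, h4⟩ ⟨k', h1', h2', h3', h4'⟩
    obtain rfl : k = k' := Fin.ext (h3.trans h3'.symm)
    have key : ∀ t : Y.EdgeTriple, Y.vtx f k = Y.fv t.1.1 →
        (t.1.1 = Y.inn f k ∧ t.1.2 = Y.out f k) ∨ (t.1.1 = Y.out f k ∧ t.1.2 = Y.inn f k) := by
      intro t ht
      have hd1 : Y.DegTwoF t.1.1 := by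
        have := h1.1
        unfold DegTwoF at this ⊢
        rwa [← ht]
      have hd2 : Y.DegTwoF t.1.2 := by
        unfold DegTwoF at hd1 ⊢
        rwa [← t.2.1]
      have a1 := hY.eq_inn_or_eq_out hd1 ht
      have a2 := hY.eq_inn_or_eq_out hd2 (ht.trans t.2.1)
      have a3 := t.2.2
      grind
    have k1 := key t h2
    have k2 := key t' h2'
    have hne := hY.inn_ne_out f k
    apply Subtype.ext
    apply Prod.ext <;> grind

/-! ### Relative cancellation and forced letters -/

/-- The number of 2-cells that pass through `v`. -/
noncomputable def visitCount (Y : AbstractDiagram ℓ) (v : Y.FV) : ℕ :=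
  {f | ∃ k, Y.vtx f k = v}.ncard

/-- A cell through a factor vertex of degree 2 uses both edges there, so no cell contains the triple
only partially. -/
theorem IsImmersed.relDegree_le (hY : Y.IsImmersed) {t : Y.EdgeTriple} (hd : Y.DegTwoF t.1.1) :
    Y.relDegree t ≤ Y.visitCount (Y.fv t.1.1) := by
  have hd2 : Y.DegTwoF t.1.2 := by
    unfold DegTwoF at hd ⊢
    rwa [← t.2.1]
  have hvis : ∀ f e, Y.Contains f e → ∃ k, Y.vtx f k = Y.fv e := by
    rintro f e ⟨k, rfl | rfl⟩
    · exact ⟨k, rfl⟩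
    · exact ⟨k, Y.fv_inn f k⟩
  have h1 : ∀ f, Y.Contains f t.1.1 → Y.Contains f t.1.2 := fun f hf => by
    obtain ⟨k, hk⟩ := hvis f _ hf
    exact ⟨k, hY.eq_inn_or_eq_out hd2 (hk.trans t.2.1)⟩
  have h2 : ∀ f, Y.Contains f t.1.2 → Y.Contains f t.1.1 := fun f hf => by
    obtain ⟨k, hk⟩ := hvis f _ hf
    exact ⟨k, hY.eq_inn_or_eq_out hd (hk.trans t.2.1.symm)⟩
  have h3 : ¬ ∃ f, Y.PartiallyContains f t := by
    rintro ⟨f, ⟨h, h'⟩ | ⟨h, h'⟩⟩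
    · exact h' (h1 f h)
    · exact h' (h2 f h)
  rw [relDegree, if_neg h3, add_zero]
  change Nat.card {f | Y.FullyContains f t} ≤ _
  rw [Nat.card_coe_set_eq]
  exact Set.ncard_le_ncard (fun f hf => hvis f _ hf.1) (Set.toFinite _)

theorem relDegree_le_area_add_one (t : Y.EdgeTriple) : Y.relDegree t ≤ Y.area + 1 := by
  rw [relDegree, area]
  refine Nat.add_le_add ?_ (by split_ifs <;> simp)
  rw [← Nat.card_eq_fintype_card]
  exact Nat.card_le_card_of_injective (fun x : {f // Y.FullyContains f t} => x.1)
    Subtype.val_injective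

/-- The letter of `f` at its first passage through `v` is matched with an earlier letter. -/
def ForcedAt (h : Y.F → Y.F → ℕ → Option (ℤ × Bool)) (q : Y.F → ℕ) (f : Y.F) (v : Y.FV) : Prop :=
  ∃ k : Fin ℓ, Y.IsFirst f k ∧ Y.vtx f k = v ∧ Forced q (h f) (q f) k

/-- Two boundary paths pass for the first time at the same time through `v`, in opposite
directions. -/
def Exceptional (h : Y.F → Y.F → ℕ → Option (ℤ × Bool)) (v : Y.FV) : Prop :=
  ∃ (f f' : Y.F) (k : Fin ℓ), Y.IsFirst f k ∧ Y.vtx f k = v ∧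
    h f f' k = some (2 * ((k : ℕ) : ℤ), false)

/-- Take the cell f₀ whose first passage through v is least for the lexicographic order on (q,
position). It forces every other cell through v, except one with the same q and the same position:
in the same direction that is a reduction pair, in the opposite direction v is exceptional. -/
theorem visitCount_le (hred : Y.IsReduced) {h : Y.F → Y.F → ℕ → Option (ℤ × Bool)}
    (hh : ∀ f f' k x, h f f' k = some x ↔ Y.Matched f f' k x) {q : Y.F → ℕ}
    (hq : ∀ f f', q f = q f' → Y.part f f') {v : Y.FV} (hd : {a | Y.fv a = v}.ncard = 2)
    (hexc : ¬ Exceptional h v) :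
    Y.visitCount v ≤ {f | ForcedAt h q f v}.ncard + 1 := by
  classical
  have hfirst : ∀ f, (∃ k, Y.vtx f k = v) → ∃ k, Y.IsFirst f k ∧ Y.vtx f k = v := by
    rintro f ⟨k, rfl⟩
    exact Y.exists_isFirst hd
  by_cases hne : ∃ f, ∃ k, Y.vtx f k = v
  swap
  · have : {f | ∃ k, Y.vtx f k = v} = ∅ :=
      Set.eq_empty_of_forall_notMem fun f hf => hne ⟨f, hf⟩
    rw [visitCount, this]
    simp
  obtain ⟨⟨f₀, k₀⟩, hmem, hmin⟩ := Finset.exists_min_image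
    (Finset.univ.filter fun x : Y.F × Fin ℓ => Y.IsFirst x.1 x.2 ∧ Y.vtx x.1 x.2 = v)
    (fun x => toLex (q x.1, x.2)) (by
      obtain ⟨f, hf⟩ := hne
      obtain ⟨k, hk⟩ := hfirst f hf
      exact ⟨(f, k), by simpa using hk⟩)
  simp only [Finset.mem_filter, Finset.mem_univ, true_and] at hmem hmin
  obtain ⟨hm1, hm2⟩ := hmem
  have hsub : {f | ∃ k, Y.vtx f k = v} ⊆ insert f₀ {f | ForcedAt h q f v} := by
    intro f hf
    by_cases hff : f = f₀
    · exact Or.inl hff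
    right
    obtain ⟨k, hk1, hk2⟩ := hfirst f hf
    have hle := hmin (f, k) ⟨hk1, hk2⟩
    rw [Prod.Lex.toLex_le_toLex] at hle
    refine ⟨k, hk1, hk2, f₀, ?_⟩
    by_cases hout : Y.out f k = Y.out f₀ k₀
    · refine ⟨(k₀ : ℤ) - k, true, (hh _ _ _ _).2
        ⟨k.2, k₀, hk1, hm1, hm2.trans hk2.symm, Or.inl ⟨hout, rfl⟩⟩, ?_⟩
      rcases hle with hlt | ⟨heq, hle⟩
      · exact Or.inl hlt
      · rcases hle.lt_or_eq with hlt | rfl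
        · refine Or.inr ⟨heq, ?_⟩
          have : (k₀ : ℕ) < k := hlt
          simp only [pos, if_true]
          omega
        · exact absurd ⟨hff, hq _ _ heq.symm, k₀, Or.inr hout⟩ (hred f f₀)
    · have hM := (hh f f₀ k ((k₀ : ℤ) + k, false)).2
        ⟨k.2, k₀, hk1, hm1, hm2.trans hk2.symm, Or.inr ⟨hout, rfl⟩⟩
      refine ⟨(k₀ : ℤ) + k, false, hM, ?_⟩
      rcases hle with hlt | ⟨heq, hle⟩
      · exact Or.inl hlt
      · rcases hle.lt_or_eq with hlt | rfl
        · refine Or.inr ⟨heq, ?_⟩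
          have : (k₀ : ℕ) < k := hlt
          simp only [pos, Bool.false_eq_true, if_false]
          omega
        · exact absurd ⟨f, f₀, k₀, hk1, hk2, by rw [hM, two_mul]⟩ hexc
  exact (Set.ncard_le_ncard hsub (Set.toFinite _)).trans (Set.ncard_insert_le _ _)

-- The two ordered triples at a vertex of degree 2 cancel the factor 1/2, so the main term counts
-- every forced letter at most once. The constant comes from triples at vertices of other degrees
-- and at exceptional vertices.
open Classical in
theorem IsImmersed.relCancellation_le (hY : Y.IsImmersed) (hred : Y.IsReduced)
    {h : Y.F → Y.F → ℕ → Option (ℤ × Bool)}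
    (hh : ∀ f f' k x, h f f' k = some x ↔ Y.Matched f f' k x) {q : Y.F → ℕ}
    (hq : ∀ f f', q f = q f' → Y.part f f') {K M : ℕ} (hKM : Y.IsBounded K M) :
    Y.relCancellation ≤ ∑ f, (forcedCount ℓ (Forced q (h f) (q f)) : ℝ) +
      (2 * M ^ 2 * K + K ^ 3 * (8 * M + 18)) := by
  have hterm : ∀ t : Y.EdgeTriple, (Y.relDegree t : ℝ) - 1 ≤
      (if ¬ Y.DegTwoF t.1.1 then (K : ℝ) else 0) +
      ((∑ f, if ForcedAt h q f (Y.fv t.1.1) then (1 : ℝ) else 0) +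
        if Exceptional h (Y.fv t.1.1) then (K : ℝ) else 0) := by
    intro t
    have hA : Y.relDegree t ≤ K + 1 := (relDegree_le_area_add_one t).trans (by
      have := hKM.1
      omega)
    have hA' : (Y.relDegree t : ℝ) - 1 ≤ K := by
      have : (Y.relDegree t : ℝ) ≤ K + 1 := by exact_mod_cast hA
      linarith
    have hF0 : (0 : ℝ) ≤ ∑ f, if ForcedAt h q f (Y.fv t.1.1) then (1 : ℝ) else 0 :=
      Finset.sum_nonneg fun f _ => by split_ifs <;> norm_num
    by_cases hd : Y.DegTwoF t.1.1
    · by_cases hexc : Exceptional h (Y.fv t.1.1)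
      · simp only [hd, hexc, not_true, if_false, if_true]
        linarith
      · simp only [hd, hexc, not_true, if_false, zero_add, add_zero]
        have h1 := (hY.relDegree_le hd).trans (visitCount_le hred hh hq hd hexc)
        have h2 : (∑ f, if ForcedAt h q f (Y.fv t.1.1) then (1 : ℝ) else 0) =
            ({f | ForcedAt h q f (Y.fv t.1.1)}.ncard : ℝ) := by
          rw [Finset.sum_boole, ← Set.ncard_coe_finset]
          simp
        rw [h2]
        have h3 : (Y.relDegree t : ℝ) ≤ {f | ForcedAt h q f (Y.fv t.1.1)}.ncard + 1 := by
          exact_mod_cast h1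
        linarith
    · have : (0 : ℝ) ≤ if Exceptional h (Y.fv t.1.1) then (K : ℝ) else 0 := by
        split_ifs <;> simp
      simp only [hd, not_false_iff, if_true]
      linarith
  -- Both edges of such a triple are special, and there are at most 2M special edges.
  have hspec : (∑ t : Y.EdgeTriple, if ¬ Y.DegTwoF t.1.1 then (K : ℝ) else 0) ≤
      (2 * M) ^ 2 * K := by
    rw [← Finset.sum_filter, Finset.sum_const, nsmul_eq_mul]
    refine mul_le_mul_of_nonneg_right ?_ (Nat.cast_nonneg K)
    have h1 : (Finset.univ.filter fun t : Y.EdgeTriple => ¬ Y.DegTwoF t.1.1).card ≤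
        (Y.specialEdges ×ˢ Y.specialEdges).ncard := by
      rw [← Set.ncard_coe_finset]
      refine Set.ncard_le_ncard_of_injOn (fun t => t.1) ?_ Subtype.val_injective.injOn
        (Set.toFinite _)
      intro t ht
      simp only [Finset.coe_filter, Finset.mem_univ, true_and, Set.mem_ofPred_eq] at ht
      refine ⟨Or.inl ht, Or.inl ?_⟩
      unfold DegTwoF at ht ⊢
      rwa [← t.2.1]
    rw [Set.ncard_prod, ← sq] at h1
    have h2 : Y.specialEdges.ncard ≤ 2 * M :=
      Y.ncard_specialEdges_le.trans (Nat.mul_le_mul_left 2 hKM.2)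
    exact_mod_cast h1.trans (Nat.pow_le_pow_left h2 2)
  have hforced : (∑ t : Y.EdgeTriple, ∑ f, if ForcedAt h q f (Y.fv t.1.1) then (1 : ℝ) else 0) ≤
      2 * ∑ f, (forcedCount ℓ (Forced q (h f) (q f)) : ℝ) := by
    rw [Finset.sum_comm, Finset.mul_sum]
    refine Finset.sum_le_sum fun f _ => ?_
    rw [Finset.sum_boole]
    have := hY.card_edgeTriple_le f (Forced q (h f) (q f))
    have h2 : (Finset.univ.filter fun t : Y.EdgeTriple => ForcedAt h q f (Y.fv t.1.1)).card ≤
        2 * forcedCount ℓ (Forced q (h f) (q f)) := by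
      convert this
      · exact Iff.rfl
      · rfl
    exact_mod_cast h2
  -- At an exceptional vertex k is the midpoint of a reflection. By `ncard_reflection_le` each of
  -- the at most K² pairs of cells has at most 8M + 18 of these, each giving at most two triples of
  -- weight at most K.
  have hexc : (∑ t : Y.EdgeTriple, if Exceptional h (Y.fv t.1.1) then (K : ℝ) else 0) ≤
      2 * (K ^ 3 * (8 * M + 18)) := by
    rw [← Finset.sum_filter, Finset.sum_const, nsmul_eq_mul]
    have h1 : (Finset.univ.filter fun t : Y.EdgeTriple => Exceptional h (Y.fv t.1.1)).card ≤
        ∑ x : Y.F × Y.F, (Finset.univ.filter fun t : Y.EdgeTriple =>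
          ∃ k : Fin ℓ, Y.IsFirst x.1 k ∧ Y.vtx x.1 k = Y.fv t.1.1 ∧
            h x.1 x.2 k = some (2 * ((k : ℕ) : ℤ), false)).card := by
      refine le_trans (Finset.card_le_card ?_) Finset.card_biUnion_le
      intro t ht
      simp only [Finset.mem_filter, Finset.mem_univ, true_and, Finset.mem_biUnion] at ht ⊢
      obtain ⟨f, f', hk⟩ := ht
      exact ⟨(f, f'), hk⟩
    have h2 : ∀ x : Y.F × Y.F, (Finset.univ.filter fun t : Y.EdgeTriple =>
          ∃ k : Fin ℓ, Y.IsFirst x.1 k ∧ Y.vtx x.1 k = Y.fv t.1.1 ∧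
            h x.1 x.2 k = some (2 * ((k : ℕ) : ℤ), false)).card ≤ 2 * (8 * M + 18) := by
      intro x
      have hle := hY.card_edgeTriple_le x.1 fun k => h x.1 x.2 k = some (2 * (k : ℤ), false)
      refine (le_of_eq (by congr!)).trans (hle.trans ?_)
      refine Nat.mul_le_mul_left 2 ?_
      have hj := (hY.mem_codes (hh x.1 x.2) hKM.2).2.2
      refine le_trans (Set.ncard_le_ncard ?_ (finite_setOf_lt_and ℓ _))
        ((ncard_reflection_le ℓ (h x.1 x.2)).trans (Nat.succ_le_succ hj))
      rintro k ⟨hk, hx⟩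
      exact ⟨hk, _, hx, by omega, by omega⟩
    have h3 := h1.trans (Finset.sum_le_sum fun x _ => h2 x)
    rw [Finset.sum_const, Finset.card_univ, Fintype.card_prod, smul_eq_mul] at h3
    have h4 : Fintype.card Y.F * Fintype.card Y.F * (2 * (8 * M + 18)) ≤
        K * K * (2 * (8 * M + 18)) :=
      Nat.mul_le_mul_right _ (Nat.mul_le_mul hKM.1 hKM.1)
    have h5 : ((Finset.univ.filter fun t : Y.EdgeTriple =>
        Exceptional h (Y.fv t.1.1)).card : ℝ) ≤ K * K * (2 * (8 * M + 18)) := by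
      exact_mod_cast h3.trans h4
    calc _ ≤ (K * K * (2 * (8 * M + 18)) : ℝ) * K :=
          mul_le_mul_of_nonneg_right h5 (Nat.cast_nonneg K)
      _ = _ := by ring
  have hsum : ∑ t : Y.EdgeTriple with ∃ f, Y.FullyContains f t, ((Y.relDegree t : ℝ) - 1) ≤
      ∑ t : Y.EdgeTriple, ((if ¬ Y.DegTwoF t.1.1 then (K : ℝ) else 0) +
      ((∑ f, if ForcedAt h q f (Y.fv t.1.1) then (1 : ℝ) else 0) +
        if Exceptional h (Y.fv t.1.1) then (K : ℝ) else 0)) := by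
    refine (Finset.sum_le_sum fun t _ => hterm t).trans ?_
    refine Finset.sum_le_sum_of_subset_of_nonneg (Finset.filter_subset _ _) fun t _ _ => ?_
    refine add_nonneg (by split_ifs <;> simp) (add_nonneg ?_ (by split_ifs <;> simp))
    exact Finset.sum_nonneg fun f _ => by split_ifs <;> norm_num
  rw [Finset.sum_add_distrib, Finset.sum_add_distrib] at hsum
  rw [relCancellation]
  linarith

theorem relCancellation_of_isEmpty [IsEmpty Y.F] : Y.relCancellation = 0 := by
  classical
  rw [relCancellation, Finset.sum_eq_zero, mul_zero]
  intro t ht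
  simp at ht

/-- A diagram with large relative cancellation yields many forced letters in few relators. -/
theorem exists_pattern {ι : Type*} {G : ι → Type*} [∀ i, Group (G i)]
    {R : Set (Fin ℓ → Σ i, G i)} (hR : ∀ w ∈ R, ∀ k, (w k).1 ≠ (w (finRotate ℓ k)).1)
    (hred : Y.IsReduced) (hful : Y.Fulfills R) {K M : ℕ} (hKM : Y.IsBounded K M) {a : ℝ}
    (hcan : a * Y.area < Y.relCancellation) :
    ∃ (N : ℕ) (q : Fin K → Fin K) (h : Fin N → Fin K → ℕ → Option (ℤ × Bool))
      (w : Fin N → Fin ℓ → Σ i, G i), 1 ≤ N ∧ N ≤ K ∧ Function.Injective w ∧ (∀ i, w i ∈ R) ∧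
      (∀ i j, h i j ∈ codes ℓ (8 * M + 17)) ∧ Satisfies (fun j => (q j : ℕ)) h w ∧
      N * (a - (2 * M ^ 2 * K + K ^ 3 * (8 * M + 18))) ≤
        ∑ i, (forcedCount ℓ (Forced (fun j => (q j : ℕ)) (h i) i) : ℝ) := by
  classical
  obtain ⟨D, hfac, hclose⟩ := hful
  have hY := D.isImmersed hR hfac
  rcases isEmpty_or_nonempty Y.F with hemp | hne
  · have h0 : Y.area = 0 := Fintype.card_eq_zero
    rw [relCancellation_of_isEmpty, h0] at hcan
    simp at hcan
  have hex : ∀ f f', ∃ h : ℕ → Option (ℤ × Bool), ∀ k x, h k = some x ↔ Y.Matched f f' k x :=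
    fun f f' => exists_option_of_functional _ (Matched.functional Y f f')
  choose h hh using hex
  obtain ⟨N₀, hN₀, e, he⟩ : ∃ N₀, N₀ = Fintype.card (Quotient Y.part) ∧
      ∃ e : Quotient Y.part ≃ Fin N₀, ∀ i j, i ≤ j →
        (Finset.univ.filter fun f => Quotient.mk Y.part f = e.symm j).card ≤
          (Finset.univ.filter fun f => Quotient.mk Y.part f = e.symm i).card :=
    ⟨_, rfl, exists_equiv_antitone fun c : Quotient Y.part =>
      (Finset.univ.filter fun f => Quotient.mk Y.part f = c).card⟩
  let q : Y.F → ℕ := fun f => e (Quotient.mk Y.part f)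
  have hqlt : ∀ f, q f < N₀ := fun f => (e (Quotient.mk Y.part f)).2
  have hqp : ∀ f f', q f = q f' → Y.part f f' := fun f f' hff =>
    Quotient.exact (e.injective (Fin.ext hff))
  have hpq : ∀ f f', Y.part f f' → q f = q f' := fun f f' hff =>
    congrArg (fun c => (e c : ℕ)) (Quotient.sound hff)
  have hN₀K : N₀ ≤ K := hN₀.trans_le <| (Fintype.card_quotient_le Y.part).trans hKM.1
  have hcan2 := hY.relCancellation_le hred hh hqp hKM
  set Γ : ℝ := 2 * M ^ 2 * K + K ^ 3 * (8 * M + 18) with hΓ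
  have hΓ0 : 0 ≤ Γ := by positivity
  let NF : Y.F → ℕ := fun f => forcedCount ℓ (Forced q (h f) (q f))
  let P : ℕ → Finset Y.F := fun i => Finset.univ.filter fun f => q f = i
  have harea : (1 : ℝ) ≤ Y.area := by
    have : 0 < Fintype.card Y.F := Fintype.card_pos
    exact_mod_cast this
  have hsplit : ∀ φ : Y.F → ℝ, ∑ f, φ f = ∑ i ∈ Finset.range N₀, ∑ f ∈ P i, φ f := fun φ =>
    (Finset.sum_fiberwise_of_maps_to (fun f _ => Finset.mem_range.2 (hqlt f)) φ).symm
  have hPcard : ∀ i : Fin N₀, P i = Finset.univ.filter fun f => Quotient.mk Y.part f = e.symm i := by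
    intro i
    ext f
    simp only [P, q, Finset.mem_filter, Finset.mem_univ, true_and]
    rw [Equiv.eq_symm_apply, Fin.ext_iff]
  -- A part of size m i, whose cells have at most x i forced letters each, contributes at most m i *
  -- x i. Since the area is at least 1, Γ is absorbed into Γ times the area.
  obtain ⟨N, hN1, hNN, hN⟩ := exists_prefix_sum_gt (N := N₀) (fun i => ((P i).card : ℝ))
    (fun i => (((P i).sup NF : ℕ) : ℝ)) (a - Γ) (fun i => Nat.cast_nonneg _)
    (fun i hi => by
      have := he ⟨i, by omega⟩ ⟨i + 1, hi⟩ (Fin.mk_le_mk.2 (by omega))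
      rw [← hPcard, ← hPcard] at this
      exact_mod_cast this)
    (by
      have h1 : (Y.area : ℝ) = ∑ i ∈ Finset.range N₀, ((P i).card : ℝ) := by
        have := hsplit fun _ => 1
        simpa [area] using this
      have h2 : ∑ f, (NF f : ℝ) ≤ ∑ i ∈ Finset.range N₀, ((P i).card : ℝ) * ((P i).sup NF : ℕ) := by
        rw [hsplit]
        refine Finset.sum_le_sum fun i _ => ?_
        rw [← nsmul_eq_mul]
        exact Finset.sum_le_card_nsmul _ _ _ fun f hf => by exact_mod_cast Finset.le_sup hf
      rw [← h1]
      have h3 : Γ ≤ Γ * Y.area := le_mul_of_one_le_right hΓ0 harea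
      have h4 : Y.relCancellation ≤ ∑ f, (NF f : ℝ) + Γ := hcan2
      linarith)
  have hrep : ∀ i : Fin N, ∃ f, q f = i ∧ NF f = (P i).sup NF := by
    intro i
    have hi : (i : ℕ) < N₀ := i.2.trans_le hNN
    have hnon : (P i).Nonempty := by
      obtain ⟨f, hf⟩ := Quotient.exists_rep (e.symm ⟨i, hi⟩)
      refine ⟨f, ?_⟩
      simp only [P, q, Finset.mem_filter, Finset.mem_univ, true_and, hf, Equiv.apply_symm_apply]
    obtain ⟨f, hf, hsup⟩ := Finset.exists_mem_eq_sup _ hnon NF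
    exact ⟨f, by simpa [P] using hf, hsup.symm⟩
  choose r hr1 hr2 using hrep
  -- Listing the cells by Fin K, with repetitions, gives patterns an index set that does not depend
  -- on Y.
  obtain ⟨emb⟩ := Function.Embedding.nonempty_of_card_le (α := Y.F) (β := Fin K)
    (by rw [Fintype.card_fin]; exact hKM.1)
  let g : Fin K → Y.F := Function.invFun emb
  have hg : Function.Surjective g := Function.invFun_surjective emb.injective
  refine ⟨N, fun j => ⟨q (g j), (hqlt _).trans_le hN₀K⟩, fun i j => h (r i) (g j),
    fun i => D.relator (r i), hN1, hNN.trans hN₀K, ?_, fun i => D.relator_mem _, ?_, ?_, ?_⟩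
  · intro i i' hii
    have := hpq _ _ ((D.relator_eq_iff _ _).1 hii)
    rw [hr1, hr1] at this
    exact Fin.ext this
  · exact fun i j => hY.mem_codes (hh _ _) hKM.2
  · intro i j k o s hs hlt
    obtain ⟨k', hk', hw⟩ := D.relator_eq_act hfac hclose hY ((hh _ _ _ _).1 hs)
    -- Letters are forced only by words with the same or a smaller number, so the first N relators
    -- form a closed system.
    have hlt' : q (g j) < N := by
      have := i.2
      simp only at hlt
      omega
    refine ⟨⟨q (g j), hlt'⟩, k', rfl, hk', ?_⟩
    have hr := (D.relator_eq_iff (r ⟨q (g j), hlt'⟩) (g j)).2 (hqp _ _ (hr1 _))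
    simp only [hr]
    exact hw
  · have hfc : ∀ i : Fin N, forcedCount ℓ (Forced (fun j => q (g j))
        (fun j => h (r i) (g j)) i) = (P i).sup NF := by
      intro i
      rw [← hr2]
      have : Forced (fun j => q (g j)) (fun j => h (r i) (g j)) i =
          Forced q (h (r i)) (q (r i)) := by
        ext k
        rw [hr1]
        exact (hg.exists (p := fun f => ∃ o s, h (r i) f k = some (o, s) ∧
          (q f < i ∨ q f = i ∧ pos s o k < k))).symm
      rw [this]
    simp only [hfc]
    rw [Fin.sum_univ_eq_sum_range (fun i => (((P i).sup NF : ℕ) : ℝ)) N]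
    exact hN.le

end AbstractDiagram
-- Balls in the factors and the growth condition
section Balls

variable {H : Type*} [Group H]

theorem finite_ball {S : Set H} (hS : S.Finite) (m : ℕ) : (ball S m).Finite := by
  have hT : (S ∪ S⁻¹).Finite := hS.union hS.inv
  have : Finite ↥(S ∪ S⁻¹) := hT
  refine ((List.finite_length_le ↥(S ∪ S⁻¹) m).image
    fun l : List ↥(S ∪ S⁻¹) => (l.map Subtype.val).prod).subset ?_
  rintro g ⟨-, l, hl, hmem, rfl⟩
  have hmem' : ∀ x ∈ l, x ∈ S ∪ S⁻¹ := hmem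
  lift l to List ↥(S ∪ S⁻¹) using hmem'
  exact ⟨l, by simpa using hl, rfl⟩

theorem mem_ball_of_mem {S : Set H} {m : ℕ} (hm : 1 ≤ m) {g : H} (hg : g ∈ S ∨ g⁻¹ ∈ S)
    (h1 : g ≠ 1) : g ∈ ball S m :=
  ⟨h1, [g], by simpa using hm, by simpa using hg, by simp⟩

theorem exists_mem_ne_one [Nontrivial H] {S : Set H} (hS : Subgroup.closure S = ⊤) :
    ∃ g ∈ S, g ≠ 1 := by
  by_contra! h
  have : Subgroup.closure S ≤ ⊥ := (Subgroup.closure_le _).2 fun g hg => h g hg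
  rw [hS, top_le_iff] at this
  exact bot_ne_top this

/-- The ball contains all nontrivial generators and their inverses. If it is a single s, then s is
its own inverse and the group is {1, s}. -/
theorem nonempty_mulEquiv_of_ncard_ball [Nontrivial H] {S : Set H}
    (hS : Subgroup.closure S = ⊤) {m : ℕ} (hm : 1 ≤ m) (hb : (ball S m).ncard = 1) :
    Nonempty (H ≃* Multiplicative (ZMod 2)) := by
  obtain ⟨a, ha⟩ := Set.ncard_eq_one.1 hb
  have huniq : ∀ g, (g ∈ S ∨ g⁻¹ ∈ S) → g ≠ 1 → g = a := fun g hg h1 => by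
    have := mem_ball_of_mem hm hg h1
    rwa [ha] at this
  obtain ⟨s, hs, hs1⟩ := exists_mem_ne_one hS
  obtain rfl := huniq s (Or.inl hs) hs1
  have hinv : s⁻¹ = s := huniq s⁻¹ (Or.inr (by simpa using hs)) (by simpa using hs1)
  have htop : ∀ g : H, g = 1 ∨ g = s := by
    intro g
    have hg : g ∈ Subgroup.closure S := by rw [hS]; trivial
    induction hg using Subgroup.closure_induction with
    | mem x hx =>
      by_cases h : x = 1
      · exact Or.inl h
      · exact Or.inr (huniq x (Or.inl hx) h)
    | one => exact Or.inl rfl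
    | mul x y _ _ hx hy =>
      rcases hx with rfl | rfl <;> rcases hy with rfl | rfl
      · simp
      · simp
      · simp
      · left
        nth_rewrite 1 [← hinv]
        simp
    | inv x _ hx =>
      rcases hx with rfl | rfl
      · simp
      · exact Or.inr hinv
  have hcard : Nat.card H = 2 := by
    rw [← Set.ncard_univ, Set.ncard_eq_two]
    refine ⟨1, s, hs1.symm, ?_⟩
    ext g
    simpa using htop g
  have : Fact (Nat.Prime 2) := ⟨Nat.prime_two⟩
  exact ⟨mulEquivOfPrimeCardEq hcard (by simp [Nat.card_eq_fintype_card])⟩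

end Balls

/-- Every term is at least 1/2, and at least 2/3 when b i ≥ 2; three halves, or 1/2 + 2/3, exceed 1.
-/
theorem one_lt_sum_div {ι : Type*} [Fintype ι] (b : ι → ℕ) (hb : ∀ i, 1 ≤ b i)
    (h : 3 ≤ Fintype.card ι ∨ 2 ≤ Fintype.card ι ∧ ∃ i, 2 ≤ b i) :
    1 < ∑ i, (b i : ℝ) / (1 + b i) := by
  classical
  have hhalf : ∀ i, (1 / 2 : ℝ) ≤ (b i : ℝ) / (1 + b i) := fun i => by
    have : (1 : ℝ) ≤ b i := by exact_mod_cast hb i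
    rw [div_le_div_iff₀ (by norm_num) (by positivity)]
    linarith
  rcases h with h | ⟨h, i₀, hi₀⟩
  · have h1 := Finset.card_nsmul_le_sum Finset.univ _ _ fun i _ => hhalf i
    rw [Finset.card_univ, nsmul_eq_mul] at h1
    have h2 : (3 : ℝ) ≤ Fintype.card ι := by exact_mod_cast h
    linarith
  · have h3 : (2 / 3 : ℝ) ≤ (b i₀ : ℝ) / (1 + b i₀) := by
      have : (2 : ℝ) ≤ b i₀ := by exact_mod_cast hi₀
      rw [div_le_div_iff₀ (by norm_num) (by positivity)]
      linarith
    have h1 := Finset.card_nsmul_le_sum (Finset.univ.erase i₀) _ _ fun i _ => hhalf i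
    rw [Finset.card_erase_of_mem (Finset.mem_univ _), Finset.card_univ, nsmul_eq_mul] at h1
    have h2 : (1 : ℝ) ≤ ((Fintype.card ι - 1 : ℕ) : ℝ) := by exact_mod_cast (by omega)
    rw [← Finset.add_sum_erase _ _ (Finset.mem_univ i₀)]
    linarith

/-! ### Bounds for cyclically reduced words -/

section Words

variable {ι : Type*} {G : ι → Type*} [∀ i, Group (G i)] {S : ∀ i, Set (G i)} {m ℓ : ℕ}

theorem mem_words_iff {B : ∀ i, Finset (G i)} (hB : ∀ i, (B i : Set (G i)) = ball (S i) m)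
    (w : Fin ℓ → Σ i, G i) :
    w ∈ words S m ℓ ↔ IsReducedSeq B w ∧
      ∀ k k' : Fin ℓ, (k : ℕ) + 1 = ℓ → (k' : ℕ) = 0 → (w k).1 ≠ (w k').1 := by
  have hmem : ∀ k, (w k).2 ∈ ball (S (w k).1) m ↔ (w k).2 ∈ B (w k).1 := fun k => by
    rw [← hB, Finset.mem_coe]
  have hlast : ∀ k k' : Fin ℓ, (k : ℕ) + 1 = ℓ → (k' : ℕ) = 0 → finRotate ℓ k = k' := by
    rintro ⟨k, hk⟩ ⟨k', hk'⟩ h h'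
    simp only at h h'
    subst h h'
    exact finRotate_last'
  constructor
  · rintro ⟨h1, h2⟩
    refine ⟨⟨fun k => (hmem k).1 (h1 k), fun k k' h => ?_⟩, fun k k' h h' => ?_⟩
    · rw [← AbstractDiagram.finRotate_eq h]
      exact h2 k
    · rw [← hlast k k' h h']
      exact h2 k
  · rintro ⟨⟨h1, h2⟩, h3⟩
    refine ⟨fun k => (hmem k).2 (h1 k), fun k => ?_⟩
    by_cases hk : (k : ℕ) + 1 < ℓ
    · rw [AbstractDiagram.finRotate_eq (k := k) (k' := ⟨k + 1, hk⟩) rfl]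
      exact h2 k _ rfl
    · have hk' := k.2
      rw [hlast k ⟨0, by omega⟩ (by omega) rfl]
      exact h3 k _ (by omega) rfl

theorem finite_words [Fintype ι] {B : ∀ i, Finset (G i)}
    (hB : ∀ i, (B i : Set (G i)) = ball (S i) m) (ℓ : ℕ) : (words S m ℓ).Finite := by
  refine (Set.Finite.pi' (fun _ : Fin ℓ => (Finset.univ.sigma B).finite_toSet)).subset ?_
  intro w hw k
  simpa using ((mem_words_iff hB w).1 hw).1.1 k

/-- Any reduced sequence of length ℓ − 1, among the many available, closes up cyclically by one more
letter; losing that letter costs a factor q. -/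
theorem pow_le_mul_ncard_words [Fintype ι] [DecidableEq ι] {B : ∀ i, Finset (G i)}
    (hB : ∀ i, (B i : Set (G i)) = ball (S i) m) (hne : ∀ i, (B i).Nonempty)
    (hcard : 2 ≤ Fintype.card ι) {q C : ℝ} {u : ι → ℝ} (hq : 0 ≤ q)
    (hu1 : ∀ i, 1 ≤ u i) (huC : ∀ i, u i ≤ C)
    (hPF : ∀ i, ∑ j with j ≠ i, ((B j).card : ℝ) * u j = q * u i) (hℓ : 2 ≤ ℓ)
    (hw : (words S m ℓ).Nonempty) :
    q ^ ℓ ≤ q * C * (words S m ℓ).ncard := by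
  classical
  obtain ⟨L, rfl⟩ : ∃ L, ℓ = L + 1 := ⟨ℓ - 1, by omega⟩
  have hL : 0 < L := by omega
  obtain ⟨w₀, hw₀⟩ := hw
  obtain ⟨W, hred, -, hWcard⟩ := exists_many_isReducedSeq B huC hPF L (w₀ 0).1
  -- The closing letter needs a factor different from those at both ends. With only two factors, the
  -- existence of w₀ makes L odd, so that both ends lie in the same factor.
  have hfill : ∀ w ∈ W, ∃ i, i ≠ (w ⟨0, hL⟩).1 ∧ i ≠ (w ⟨L - 1, by omega⟩).1 := by
    intro w hwW
    rcases hcard.lt_or_eq with h3 | h2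
    · have : ({(w ⟨0, hL⟩).1, (w ⟨L - 1, by omega⟩).1} : Finset ι).card <
          (Finset.univ : Finset ι).card :=
        Finset.card_le_two.trans_lt (by rwa [Finset.card_univ])
      obtain ⟨i, -, hi⟩ := Finset.exists_mem_notMem_of_card_lt_card this
      simp only [Finset.mem_insert, Finset.mem_singleton, not_or] at hi
      exact ⟨i, hi⟩
    · have h2' : ∀ x y z : ι, x ≠ y → y ≠ z → x = z := by
        intro x y z hxy hyz
        by_contra hxz
        have : ({x, y, z} : Finset ι).card ≤ Fintype.card ι := Finset.card_le_univ _
        rw [Finset.card_eq_three.2 ⟨x, y, z, hxy, hxz, hyz, rfl⟩] at this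
        omega
      obtain ⟨hr, hc⟩ := (mem_words_iff hB w₀).1 hw₀
      have hodd : ¬ Even L := by
        rw [← hr.eq_iff_even h2' (by omega) L (by omega)]
        exact hc _ _ rfl rfl
      have heven : Even (L - 1) := by
        rcases Nat.even_or_odd L with h | h
        · exact absurd h hodd
        · exact Nat.Odd.sub_odd h odd_one
      have heq := ((hred w hwW).eq_iff_even h2' hL (L - 1) (by omega)).2 heven
      have : Nontrivial ι := Fintype.one_lt_card_iff_nontrivial.1 (by omega)
      obtain ⟨i, hi⟩ := exists_ne (w ⟨0, hL⟩).1
      exact ⟨i, hi, by rwa [heq]⟩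
  have hletter : ∀ w : Fin L → Σ i, G i, ∃ a : Σ i, G i, w ∈ W → a.2 ∈ B a.1 ∧
      a.1 ≠ (w ⟨0, hL⟩).1 ∧ a.1 ≠ (w ⟨L - 1, by omega⟩).1 := by
    intro w
    by_cases hwW : w ∈ W
    · obtain ⟨i, hi⟩ := hfill w hwW
      obtain ⟨g, hg⟩ := hne i
      exact ⟨⟨i, g⟩, fun _ => ⟨hg, hi⟩⟩
    · exact ⟨w₀ 0, fun h => absurd h hwW⟩
  choose a ha using hletter
  have hle : W.card ≤ (words S m (L + 1)).ncard := by
    rw [← Set.ncard_coe_finset]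
    refine Set.ncard_le_ncard_of_injOn
      (fun w => (Fin.cons (a w) w : Fin (L + 1) → Σ i, G i)) ?_ ?_ (finite_words hB _)
    · intro w hwW
      obtain ⟨h1, h2, h3⟩ := ha w hwW
      rw [mem_words_iff hB]
      refine ⟨(hred w hwW).cons h1 fun k hk => ?_, fun k k' hk hk' => ?_⟩
      · obtain rfl : k = ⟨0, hL⟩ := Fin.ext hk
        exact h2.symm
      · obtain rfl : k' = 0 := Fin.ext hk'
        have hk1 : k = Fin.succ ⟨L - 1, by omega⟩ := Fin.ext (by simp; omega)
        rw [hk1]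
        exact h3.symm
    · intro w _ w' _ h
      exact (Fin.cons_injective2 h).2
  have hC0 : 0 ≤ C := zero_le_one.trans ((hu1 (w₀ 0).1).trans (huC _))
  have h1 : q ^ L ≤ C * W.card := by
    refine le_trans ?_ hWcard
    exact le_mul_of_one_le_right (pow_nonneg hq _) (hu1 _)
  have h2 : (W.card : ℝ) ≤ (words S m (L + 1)).ncard := by exact_mod_cast hle
  calc q ^ (L + 1) = q * q ^ L := by ring
    _ ≤ q * (C * (words S m (L + 1)).ncard) :=
        mul_le_mul_of_nonneg_left (h1.trans (mul_le_mul_of_nonneg_left h2 hC0)) hq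
    _ = _ := by ring

/-- Few tuples of words satisfy given identifications. -/
theorem card_satisfies_le [Fintype ι] [DecidableEq ι] {B : ∀ i, Finset (G i)}
    (hB : ∀ i, (B i : Set (G i)) = ball (S i) m) (hcard : 2 ≤ Fintype.card ι)
    {r C : ℝ} {u : ι → ℝ} (hq : 0 ≤ r)
    (hu1 : ∀ i, 1 ≤ u i) (huC : ∀ i, u i ≤ C)
    (hPF : ∀ i, ∑ j with j ≠ i, ((B j).card : ℝ) * u j = r * u i) (hℓ : 0 < ℓ)
    {N K J : ℕ} (q : Fin K → ℕ) (h : Fin N → Fin K → ℕ → Option (ℤ × Bool))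
    (hJ : ∀ i j, jumpCount ℓ (h i j) ≤ J) (W : Finset (Fin N → Fin ℓ → Σ i, G i))
    (hW : ∀ w ∈ W, ∀ i, w i ∈ words S m ℓ) (hsat : ∀ w ∈ W, Satisfies q h w) :
    (W.card : ℝ) ≤ (Fintype.card ι * C ^ (K * (2 * J + 1) + 1)) ^ N *
      r ^ (∑ i, freeCount ℓ (Forced q (h i) i)) := by
  classical
  have : Nontrivial ι := Fintype.one_lt_card_iff_nontrivial.1 (by omega)
  obtain ⟨i₀⟩ : Nonempty ι := inferInstance
  have hC1 : 1 ≤ C := (hu1 i₀).trans (huC i₀)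
  have hC0 : 0 ≤ C := by linarith
  refine (card_le_prod_of_fibers W (fun i => (Fintype.card ι * C ^ (K * (2 * J + 1) + 1)) *
    r ^ freeCount ℓ (Forced q (h i) i)) (fun i => by positivity) ?_).trans ?_
  · intro i w₀
    set V := (W.filter fun w => ∀ i' < i, w i' = w₀ i').image fun w => w i with hV
    have hVw : ∀ v ∈ V, v ∈ words S m ℓ := by
      intro v hv
      simp only [hV, Finset.mem_image, Finset.mem_filter] at hv
      obtain ⟨w, ⟨hw, -⟩, rfl⟩ := hv
      exact hW w hw i
    have hVred : ∀ v ∈ V, IsReducedSeq B v := fun v hv => ((mem_words_iff hB v).1 (hVw v hv)).1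
    have hVdet : ∀ v ∈ V, ∀ v' ∈ V, ∀ k : Fin ℓ, Forced q (h i) i k →
        (∀ k' < k, v k' = v' k') → v k = v' k := by
      intro v hv v' hv' k hk hlt
      simp only [hV, Finset.mem_image, Finset.mem_filter] at hv hv'
      obtain ⟨w, ⟨hw, hw0⟩, rfl⟩ := hv
      obtain ⟨w', ⟨hw', hw0'⟩, rfl⟩ := hv'
      obtain ⟨j, o, s, hs, hc⟩ := hk
      obtain ⟨i₁, k₁, hi₁, hk₁, e₁⟩ := hsat w hw i j k o s hs hc
      obtain ⟨i₂, k₂, hi₂, hk₂, e₂⟩ := hsat w' hw' i j k o s hs hc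
      obtain rfl : i₁ = i₂ := Fin.ext (hi₁.trans hi₂.symm)
      obtain rfl : k₁ = k₂ := Fin.ext (by omega)
      rw [e₁, e₂]
      congr 1
      rcases hc with hc | ⟨hc, hc'⟩
      · have : i₁ < i := Fin.lt_def.2 (by omega)
        rw [hw0 i₁ this, hw0' i₁ this]
      · obtain rfl : i₁ = i := Fin.ext (by omega)
        exact hlt k₁ (Fin.lt_def.2 (by omega))
    have hbd : C ^ boundaryCount ℓ (Forced q (h i) i) ≤ C ^ (K * (2 * J + 1)) := by
      refine pow_le_pow_right₀ hC1 ?_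
      have := boundaryCount_forced_le q (h i) i ℓ J (hJ i)
      rwa [Fintype.card_fin] at this
    -- The bound for determined sequences requires a factor avoided by the first letter. Summing
    -- over all possible x produces the factor `Fintype.card ι`.
    have hpart : ∀ x : ι, ((V.filter fun v => (v ⟨0, hℓ⟩).1 ≠ x).card : ℝ) ≤
        C ^ (K * (2 * J + 1) + 1) * r ^ freeCount ℓ (Forced q (h i) i) := by
      intro x
      refine (card_le_of_determined B hq hu1 huC hPF ℓ
        (V.filter fun v => (v ⟨0, hℓ⟩).1 ≠ x) (Forced q (h i) i) x
        (fun v hv => hVred v (Finset.mem_filter.1 hv).1) ?_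
        (fun v hv v' hv' => hVdet v (Finset.mem_filter.1 hv).1 v' (Finset.mem_filter.1 hv').1)).1.trans
        ?_
      · intro v hv k hk
        obtain rfl : k = ⟨0, hℓ⟩ := Fin.ext hk
        exact (Finset.mem_filter.1 hv).2
      · calc _ ≤ C ^ (K * (2 * J + 1)) * r ^ freeCount ℓ (Forced q (h i) i) * C := by gcongr
          _ = _ := by ring
    have hcover : V ⊆ Finset.univ.biUnion fun x => V.filter fun v => (v ⟨0, hℓ⟩).1 ≠ x := by
      intro v hv
      obtain ⟨x, hx⟩ := exists_ne (v ⟨0, hℓ⟩).1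
      simp only [Finset.mem_biUnion, Finset.mem_univ, true_and, Finset.mem_filter]
      exact ⟨x, hv, hx.symm⟩
    have h1 : (V.card : ℝ) ≤ ∑ x : ι, ((V.filter fun v => (v ⟨0, hℓ⟩).1 ≠ x).card : ℝ) := by
      exact_mod_cast (Finset.card_le_card hcover).trans Finset.card_biUnion_le
    refine h1.trans ((Finset.sum_le_card_nsmul _ _ _ fun x _ => hpart x).trans (le_of_eq ?_))
    rw [Finset.card_univ, nsmul_eq_mul]
    ring
  · rw [Finset.prod_mul_distrib, Finset.prod_const, Finset.card_univ, Fintype.card_fin,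
      Finset.prod_pow_eq_pow_sum]

end Words

/-! ### Probability estimates and the union bound -/

/-- Draws at distinct indices are independent and uniform. The injection exchanges the coordinates
of ω selected by j with an arbitrary N-tuple. -/
theorem card_filter_comp_mem_mul_le {T : Type*} [Fintype T] [DecidableEq T] {N L : ℕ}
    {j : Fin N → Fin L} (hj : Function.Injective j) (A : Finset (Fin N → T)) :
    (Finset.univ.filter fun ω : Fin L → T => ω ∘ j ∈ A).card * Fintype.card T ^ N ≤
      A.card * Fintype.card T ^ L := by
  have h1 : ∀ n, Fintype.card T ^ n = (Finset.univ : Finset (Fin n → T)).card := fun n => by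
    simp [Finset.card_univ]
  rw [h1, h1, ← Finset.card_product, ← Finset.card_product]
  refine Finset.card_le_card_of_injOn (fun x => (x.1 ∘ j, Function.extend j x.2 x.1)) ?_ ?_
  · rintro ⟨ω, w⟩ hx
    simp only [Finset.coe_product, Finset.coe_filter, Finset.coe_univ, Finset.mem_univ, true_and,
      Set.mem_prod, Set.mem_ofPred_eq, Set.mem_univ, and_true, Finset.mem_coe] at hx ⊢
    exact hx
  · rintro ⟨ω, w⟩ - ⟨ω', w'⟩ - h
    simp only [Prod.mk.injEq] at h
    obtain ⟨h1, h2⟩ := h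
    have hw : w = w' := by
      ext i
      have := congrFun h2 (j i)
      rwa [hj.extend_apply, hj.extend_apply] at this
    have hω : ω = ω' := by
      ext x
      by_cases hx : ∃ i, j i = x
      · obtain ⟨i, rfl⟩ := hx
        exact congrFun h1 i
      · have := congrFun h2 x
        rwa [Function.extend_apply' _ _ _ hx, Function.extend_apply' _ _ _ hx] at this
    rw [hw, hω]

theorem one_sub_le_uniformOn {Ω : Type*} [Fintype Ω] [Nonempty Ω] (A : Set Ω) {x : ℝ}
    (hx : ((Aᶜ).ncard : ℝ) ≤ x * Fintype.card Ω) :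
    1 - ENNReal.ofReal x ≤ @uniformOn Ω ⊤ Set.univ A := by
  let _ : MeasurableSpace Ω := ⊤
  have : DiscreteMeasurableSpace Ω := ⟨fun _ => trivial⟩
  have hadd := uniformOn_compl (s := (Set.univ : Set Ω)) A Set.finite_univ Set.univ_nonempty
  have hpos : (0 : ℝ) < Fintype.card Ω := by exact_mod_cast Fintype.card_pos
  have hc : uniformOn Set.univ Aᶜ ≤ ENNReal.ofReal x := by
    rw [uniformOn_univ, MeasureTheory.Measure.count_apply (MeasurableSet.of_discrete),
      ← Set.Finite.cast_ncard_eq (Set.toFinite _), ENat.toENNReal_coe]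
    refine ENNReal.div_le_of_le_mul ?_
    have h0 : 0 ≤ x := by
      by_contra! h0
      have : (0 : ℝ) ≤ (Aᶜ).ncard := Nat.cast_nonneg _
      nlinarith
    have h1 := ENNReal.ofReal_le_ofReal hx
    rw [ENNReal.ofReal_mul h0, ENNReal.ofReal_natCast, ENNReal.ofReal_natCast] at h1
    exact h1
  rw [← hadd]
  exact tsub_le_iff_right.2 (add_le_add_right hc _)

theorem card_codes_le (ℓ J : ℕ) :
    (codes ℓ J).Finite ∧ (codes ℓ J).ncard ≤ (7 * (ℓ + 1) ^ 2) ^ (J + 1) := by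
  obtain ⟨h1, h2⟩ := finite_and_ncard_le_of_jumpCount (codeValues ℓ) none ℓ J
  refine ⟨h1, h2.trans (Nat.pow_le_pow_left ?_ _)⟩
  rw [card_codeValues]
  nlinarith

/-- Only a lower bound for s, the number of words, is needed: as 1 − d > 0, the factor (q ^ x) ^ (1
− d) is at most a constant times s ^ (1 − d), which together with L ≤ s ^ d makes up s and leaves
the gain q ^ (−ε x). -/
theorem density_estimate {q c s L d ε Γ x : ℝ} (hq : 0 < q) (hc : 0 < c) (hs : 0 < s)
    (hd1 : d < 1) (hL : L ≤ s ^ d) (hqs : q ^ x ≤ c * s) :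
    L * q ^ (x - ((d + ε) * x - Γ)) ≤ c ^ (1 - d) * q ^ Γ * (q ^ (-ε)) ^ x * s := by
  have e1 : q ^ (x - ((d + ε) * x - Γ)) = (q ^ x) ^ (1 - d) * (q ^ Γ * (q ^ (-ε)) ^ x) := by
    rw [← Real.rpow_mul hq.le, ← Real.rpow_mul hq.le, ← Real.rpow_add hq, ← Real.rpow_add hq]
    congr 1
    ring
  have e2 : (q ^ x) ^ (1 - d) ≤ c ^ (1 - d) * s ^ (1 - d) := by
    rw [← Real.mul_rpow hc.le hs.le]
    exact Real.rpow_le_rpow (by positivity) hqs (by linarith)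
  have e3 : s ^ d * s ^ (1 - d) = s := by
    rw [← Real.rpow_add hs]
    simp
  have hP : 0 ≤ q ^ Γ * (q ^ (-ε)) ^ x := by positivity
  calc L * q ^ (x - ((d + ε) * x - Γ))
      = L * ((q ^ x) ^ (1 - d) * (q ^ Γ * (q ^ (-ε)) ^ x)) := by rw [e1]
    _ ≤ s ^ d * ((c ^ (1 - d) * s ^ (1 - d)) * (q ^ Γ * (q ^ (-ε)) ^ x)) := by gcongr
    _ = c ^ (1 - d) * q ^ Γ * (q ^ (-ε)) ^ x * (s ^ d * s ^ (1 - d)) := by ring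
    _ = _ := by rw [e3]

theorem sum_pow_le_mul {x : ℝ} (hx0 : 0 ≤ x) (hx1 : x ≤ 1) (K : ℕ) :
    ∑ N ∈ Finset.Icc 1 K, x ^ N ≤ K * x := by
  refine (Finset.sum_le_card_nsmul _ _ x fun N hN => ?_).trans (by simp)
  exact pow_le_of_le_one hx0 hx1 (by have := (Finset.mem_Icc.1 hN).1; omega)

section BadSamples

variable {ι : Type*} {G : ι → Type*} [∀ i, Group (G i)]

/-- The samples with relators which fulfill a bad diagram. -/
def badSamples (S : ∀ i, Set (G i)) (m : ℕ) (d : ℝ) (K M : ℕ) (ε : ℝ) (ℓ : ℕ) :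
    Set (Sample S m d ℓ) :=
  {ω | ∃ Y : AbstractDiagram ℓ, Y.IsReduced ∧ Y.Fulfills (relators ω) ∧ Y.IsBounded K M ∧
    (d + ε) * Y.area * ℓ < Y.relCancellation}

theorem prob_not_eq (S : ∀ i, Set (G i)) (m : ℕ) (d : ℝ) (K M : ℕ) (ε : ℝ) (ℓ : ℕ) :
    (prob S m d ℓ fun R => ¬ ∃ Y : AbstractDiagram ℓ, Y.IsReduced ∧ Y.Fulfills R ∧
      Y.IsBounded K M ∧ (d + ε) * Y.area * ℓ < Y.relCancellation) =
    @uniformOn (Sample S m d ℓ) ⊤ Set.univ (badSamples S m d K M ε ℓ)ᶜ := rfl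

end BadSamples

section Estimate

variable {ι : Type*} [Fintype ι] [DecidableEq ι] {G : ι → Type*} [∀ i, Group (G i)]
  {S : ∀ i, Set (G i)} {m ℓ : ℕ}

open Classical in
/-- Union bound over all identification patterns. -/
theorem ncard_badSamples_le [Fintype (words S m ℓ)] {B : ∀ i, Finset (G i)}
    (hB : ∀ i, (B i : Set (G i)) = ball (S i) m) (hcard : 2 ≤ Fintype.card ι)
    {r C : ℝ} {u : ι → ℝ} (hr : 1 < r) (hu1 : ∀ i, 1 ≤ u i) (huC : ∀ i, u i ≤ C)
    (hPF : ∀ i, ∑ j with j ≠ i, ((B j).card : ℝ) * u j = r * u i) (hℓ : 0 < ℓ)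
    (d : ℝ) (K M : ℕ) (ε : ℝ) :
    ((badSamples S m d K M ε ℓ).ncard : ℝ) ≤
      ∑ N ∈ Finset.Icc 1 K, (K : ℝ) ^ K *
        (((codes ℓ (8 * M + 17)).ncard : ℝ) ^ K *
          (Fintype.card ι * C ^ (K * (2 * (8 * M + 17) + 1) + 1)) *
          ((numRelators S m d ℓ : ℝ) *
            r ^ ((ℓ : ℝ) - ((d + ε) * ℓ - (2 * M ^ 2 * K + K ^ 3 * (8 * M + 18))))) /
          Fintype.card (words S m ℓ)) ^ N * Fintype.card (words S m ℓ) ^ numRelators S m d ℓ := by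
  obtain ⟨i₀⟩ : Nonempty ι := Fintype.card_pos_iff.1 (by omega)
  have hC0 : 0 ≤ C := zero_le_one.trans ((hu1 i₀).trans (huC i₀))
  set J := 8 * M + 17 with hJ
  set L := numRelators S m d ℓ with hL
  set a : ℝ := (d + ε) * ℓ - (2 * M ^ 2 * K + K ^ 3 * (8 * M + 18)) with ha
  set A₀ : ℝ := Fintype.card ι * C ^ (K * (2 * J + 1) + 1) with hA₀
  have hA₀0 : 0 ≤ A₀ := by positivity
  set s := Fintype.card (words S m ℓ) with hs
  let Hf : Finset (ℕ → Option (ℤ × Bool)) := (card_codes_le ℓ J).1.toFinset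
  have hHf : Hf.card = (codes ℓ J).ncard := (Set.ncard_eq_toFinset_card _ _).symm
  let HN : ∀ N : ℕ, Finset (Fin N → Fin K → ℕ → Option (ℤ × Bool)) := fun N =>
    Fintype.piFinset fun _ => Fintype.piFinset fun _ => Hf
  have hHN : ∀ N, (HN N).card = (Hf.card ^ K) ^ N := fun N => by
    simp [HN, Fintype.card_piFinset]
  let A : ∀ N : ℕ, (Fin K → Fin K) → (Fin N → Fin K → ℕ → Option (ℤ × Bool)) →
      Finset (Fin N → words S m ℓ) := fun N q h =>
    Finset.univ.filter fun w =>
      Satisfies (fun j => (q j : ℕ)) h (fun i => (w i : Fin ℓ → Σ i, G i)) ∧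
      N * a ≤ ∑ i, (forcedCount ℓ (Forced (fun j => (q j : ℕ)) (h i) i) : ℝ)
  let E : ∀ N : ℕ, (Fin K → Fin K) → (Fin N → Fin K → ℕ → Option (ℤ × Bool)) →
      (Fin N → Fin L) → Finset (Sample S m d ℓ) := fun N q h j =>
    Finset.univ.filter fun ω : Fin L → words S m ℓ => Function.Injective j ∧ ω ∘ j ∈ A N q h
  -- The quantifier over all diagrams is replaced by finite data: N, the part numbers q, the codes h
  -- and the indices j of the drawn relators.
  have hcover : badSamples S m d K M ε ℓ ⊆
      ((Finset.Icc 1 K).biUnion fun N => Finset.univ.biUnion fun q : Fin K → Fin K =>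
        (HN N).biUnion fun h => Finset.univ.biUnion fun j => E N q h j :
          Finset (Sample S m d ℓ)) := by
    rintro ω ⟨Y, hred, hful, hKM, hcan⟩
    obtain ⟨N, q, h, w, hN1, hNK, hwinj, hwR, hcodes, hsat, hsum⟩ :=
      AbstractDiagram.exists_pattern (a := (d + ε) * ℓ) (by
        rintro _ ⟨j, rfl⟩
        exact (ω j).2.2) hred hful hKM (by
        calc (d + ε) * ℓ * Y.area = (d + ε) * Y.area * ℓ := by ring
          _ < _ := hcan)
    choose j hj using hwR
    have hj' : ∀ i, ((ω (j i) : words S m ℓ) : Fin ℓ → Σ i, G i) = w i := hj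
    rw [Finset.mem_coe]
    simp only [Finset.mem_biUnion, Finset.mem_Icc, Finset.mem_univ, true_and]
    refine ⟨N, ⟨hN1, hNK⟩, q, h, ?_, j, ?_⟩
    · simp only [HN, Hf, Fintype.mem_piFinset, Set.Finite.mem_toFinset]
      exact hcodes
    · simp only [E, A, Finset.mem_filter, Finset.mem_univ, true_and, Function.comp_apply]
      refine ⟨fun i i' hii => hwinj ?_, ?_, hsum⟩
      · rw [← hj', ← hj', hii]
      · have : (fun i => ((ω (j i) : words S m ℓ) : Fin ℓ → Σ i, G i)) = w := funext hj'
        rw [this]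
        exact hsat
  have hA : ∀ N q h, h ∈ HN N → ((A N q h).card : ℝ) ≤ A₀ ^ N * (r ^ ((ℓ : ℝ) - a)) ^ N := by
    intro N q h hh
    rcases (A N q h).eq_empty_or_nonempty with hemp | ⟨w₁, hw₁⟩
    · rw [hemp]
      simp only [Finset.card_empty, Nat.cast_zero]
      positivity
    have hforced : N * a ≤ ∑ i, (forcedCount ℓ (Forced (fun j => (q j : ℕ)) (h i) i) : ℝ) := by
      simp only [A, Finset.mem_filter] at hw₁
      exact hw₁.2.2
    have hjump : ∀ i j, jumpCount ℓ (h i j) ≤ J := by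
      intro i j
      simp only [HN, Hf, Fintype.mem_piFinset, Set.Finite.mem_toFinset] at hh
      exact (hh i j).2.2
    have h1 := card_satisfies_le hB hcard (by linarith : 0 ≤ r) hu1 huC hPF hℓ
      (fun j => (q j : ℕ)) h hjump
      ((A N q h).image fun w i => (w i : Fin ℓ → Σ i, G i))
      (by
        intro w hw i
        obtain ⟨w, -, rfl⟩ := Finset.mem_image.1 hw
        exact (w i).2)
      (by
        intro w hw
        obtain ⟨w', hw', rfl⟩ := Finset.mem_image.1 hw
        exact (Finset.mem_filter.1 hw').2.1)
    rw [Finset.card_image_of_injective _ (fun w w' hww => by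
      ext1 i
      exact Subtype.ext (congrFun hww i))] at h1
    refine h1.trans (mul_le_mul_of_nonneg_left ?_ (by positivity))
    rw [← Real.rpow_natCast, ← Real.rpow_natCast (r ^ _), ← Real.rpow_mul (by linarith)]
    refine Real.rpow_le_rpow_of_exponent_le hr.le ?_
    have h2 : ((∑ i, freeCount ℓ (Forced (fun j => (q j : ℕ)) (h i) i) : ℕ) : ℝ) =
        N * ℓ - ∑ i, (forcedCount ℓ (Forced (fun j => (q j : ℕ)) (h i) i) : ℝ) := by
      have h3 : ∑ i : Fin N, ((forcedCount ℓ (Forced (fun j => (q j : ℕ)) (h i) i) : ℝ) +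
          freeCount ℓ (Forced (fun j => (q j : ℕ)) (h i) i)) = ∑ i : Fin N, (ℓ : ℝ) :=
        Finset.sum_congr rfl fun i _ => by exact_mod_cast forcedCount_add_freeCount _ _
      rw [Finset.sum_add_distrib, Finset.sum_const, Finset.card_univ, Fintype.card_fin,
        nsmul_eq_mul] at h3
      push_cast
      linarith
    rw [h2]
    linarith
  have hE : ∀ N q h j, h ∈ HN N → ((E N q h j).card : ℝ) ≤
      A₀ ^ N * (r ^ ((ℓ : ℝ) - a)) ^ N * (s : ℝ) ^ L / (s : ℝ) ^ N := by
    intro N q h j hh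
    rcases (E N q h j).eq_empty_or_nonempty with hemp | ⟨ω, hω⟩
    · rw [hemp]
      simp only [Finset.card_empty, Nat.cast_zero]
      positivity
    have hω' : Function.Injective j ∧ ω ∘ j ∈ A N q h := (Finset.mem_filter.1 hω).2
    -- Independence needs distinct indices, which come from the distinctness of the N relators.
    have hcardE : (E N q h j).card * s ^ N ≤ (A N q h).card * s ^ L := by
      refine le_trans (Nat.mul_le_mul_right _ (Finset.card_le_card ?_))
        (card_filter_comp_mem_mul_le hω'.1 (A N q h))
      intro ω₁ hω₁
      exact Finset.mem_filter.2 ⟨Finset.mem_univ _, (Finset.mem_filter.1 hω₁).2.2⟩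
    have hspos : (0 : ℝ) < (s : ℝ) ^ N := by
      rcases Nat.eq_zero_or_pos N with rfl | hN
      · simp
      · have : 0 < s := Fintype.card_pos_iff.2 ⟨ω (j ⟨0, hN⟩)⟩
        positivity
    rw [le_div_iff₀ hspos]
    calc ((E N q h j).card : ℝ) * (s : ℝ) ^ N ≤ (A N q h).card * (s : ℝ) ^ L := by
          exact_mod_cast hcardE
      _ ≤ _ := mul_le_mul_of_nonneg_right (hA N q h hh) (by positivity)
  have hbad := Set.ncard_le_ncard hcover (Finset.finite_toSet _)
  rw [Set.ncard_coe_finset] at hbad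
  have h1 : ((badSamples S m d K M ε ℓ).ncard : ℝ) ≤ ∑ N ∈ Finset.Icc 1 K,
      ∑ _q : Fin K → Fin K, ∑ _h ∈ HN N, ∑ _j : Fin N → Fin L,
        A₀ ^ N * (r ^ ((ℓ : ℝ) - a)) ^ N * (s : ℝ) ^ L / (s : ℝ) ^ N := by
    refine le_trans (Nat.cast_le.2 hbad) ?_
    refine le_trans (Nat.cast_le.2 Finset.card_biUnion_le) ?_
    rw [Nat.cast_sum]
    refine Finset.sum_le_sum fun N _ => ?_
    refine le_trans (Nat.cast_le.2 Finset.card_biUnion_le) ?_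
    rw [Nat.cast_sum]
    refine Finset.sum_le_sum fun q _ => ?_
    refine le_trans (Nat.cast_le.2 Finset.card_biUnion_le) ?_
    rw [Nat.cast_sum]
    refine Finset.sum_le_sum fun h hh => ?_
    refine le_trans (Nat.cast_le.2 Finset.card_biUnion_le) ?_
    rw [Nat.cast_sum]
    exact Finset.sum_le_sum fun j _ => hE N q h j hh
  refine h1.trans (Finset.sum_le_sum fun N _ => le_of_eq ?_)
  simp only [Finset.sum_const, Finset.card_univ, hHN, nsmul_eq_mul, Fintype.card_fun,
    Fintype.card_fin, hHf]
  push_cast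
  rw [div_pow, mul_pow, mul_pow, mul_pow]
  ring

theorem withOverwhelmingProbability_of_perron {B : ∀ i, Finset (G i)}
    (hB : ∀ i, (B i : Set (G i)) = ball (S i) m) (hne : ∀ i, (B i).Nonempty)
    (hcard : 2 ≤ Fintype.card ι)
    {r C : ℝ} {u : ι → ℝ} (hr : 1 < r) (hu1 : ∀ i, 1 ≤ u i) (huC : ∀ i, u i ≤ C)
    (hPF : ∀ i, ∑ j with j ≠ i, ((B j).card : ℝ) * u j = r * u i)
    {d : ℝ} (hd0 : 0 < d) (hd1 : d < 1) (K M : ℕ) {ε : ℝ} (hε : 0 < ε) :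
    WithOverwhelmingProbability S m d fun ℓ R =>
      ¬ ∃ Y : AbstractDiagram ℓ, Y.IsReduced ∧ Y.Fulfills R ∧ Y.IsBounded K M ∧
          (d + ε) * Y.area * ℓ < Y.relCancellation := by
  classical
  obtain ⟨i₀⟩ : Nonempty ι := Fintype.card_pos_iff.1 (by omega)
  have hC1 : 1 ≤ C := (hu1 i₀).trans (huC i₀)
  have hr0 : 0 < r := by linarith
  set Γ : ℝ := 2 * M ^ 2 * K + K ^ 3 * (8 * M + 18) with hΓ
  set A₀ : ℝ := Fintype.card ι * C ^ (K * (2 * (8 * M + 17) + 1) + 1) with hA₀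
  have hA₀0 : 0 ≤ A₀ := by positivity
  set ρ : ℝ := r ^ (-ε) with hρ
  have hρ0 : 0 < ρ := by positivity
  have hρ1 : ρ < 1 := Real.rpow_lt_one_of_one_lt_of_neg hr (by linarith)
  set D : ℝ := A₀ * ((r * C) ^ (1 - d) * r ^ Γ) with hD
  have hD0 : 0 ≤ D := by positivity
  -- The cost per relator: the number of codes, a constant, and the exponential gain from ε. Once x
  -- ℓ ≤ 1, all powers with N ≥ 1 are at most x ℓ.
  let x : ℕ → ℝ := fun ℓ => (7 * ((ℓ : ℝ) + 1) ^ 2) ^ ((8 * M + 17 + 1) * K) * D * ρ ^ ℓ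
  have hx0 : ∀ ℓ, 0 ≤ x ℓ := fun ℓ => by positivity
  have hxlim : Tendsto x atTop (𝓝 0) := by
    have h1 := (tendsto_pow_const_mul_const_pow_of_abs_lt_one (2 * ((8 * M + 17 + 1) * K))
      (r := ρ) (by rwa [abs_of_pos hρ0])).comp (tendsto_add_atTop_nat 1)
    have h2 := h1.const_mul (7 ^ ((8 * M + 17 + 1) * K) * D / ρ)
    rw [mul_zero] at h2
    refine h2.congr fun ℓ => ?_
    simp only [Function.comp_apply, x]
    push_cast
    rw [mul_pow, ← pow_mul, pow_succ ρ]
    field_simp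
  have hmain : ∀ ℓ, 2 ≤ ℓ → x ℓ ≤ 1 →
      1 - ENNReal.ofReal ((K : ℝ) ^ K * (K * x ℓ)) ≤
        prob S m d ℓ fun R => ¬ ∃ Y : AbstractDiagram ℓ, Y.IsReduced ∧ Y.Fulfills R ∧
          Y.IsBounded K M ∧ (d + ε) * Y.area * ℓ < Y.relCancellation := by
    intro ℓ hℓ hx1
    have _ : Fintype (words S m ℓ) := (finite_words hB ℓ).fintype
    have hsn : Fintype.card (words S m ℓ) = (words S m ℓ).ncard := by
      rw [← Nat.card_eq_fintype_card, Nat.card_coe_set_eq]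
    have hbound := ncard_badSamples_le (ℓ := ℓ) hB hcard hr hu1 huC hPF (by omega) d K M ε
    rw [prob_not_eq]
    rcases (words S m ℓ).eq_empty_or_nonempty with hemp | hnon
    -- There are no words, for example, for two factors and ℓ odd. Then no relator is drawn because
    -- 0 ^ d = 0, and the union bound is 0 because division by zero gives 0 and N ≥ 1.
    · have hL0 : numRelators S m d ℓ = 0 := by
        rw [numRelators, hemp]
        simp [Real.zero_rpow hd0.ne']
      have : IsEmpty (Fin (numRelators S m d ℓ)) := by rw [hL0]; infer_instance
      have : Nonempty (Sample S m d ℓ) := ⟨fun j => isEmptyElim j⟩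
      refine one_sub_le_uniformOn _ ?_
      rw [compl_compl]
      refine hbound.trans ?_
      have hs0 : Fintype.card (words S m ℓ) = 0 := by rw [hsn, hemp, Set.ncard_empty]
      rw [hs0]
      have hz : ∀ N ∈ Finset.Icc 1 K, (K : ℝ) ^ K *
        (((codes ℓ (8 * M + 17)).ncard : ℝ) ^ K * A₀ * ((numRelators S m d ℓ : ℝ) *
            r ^ ((ℓ : ℝ) - ((d + ε) * ℓ - Γ))) / ((0 : ℕ) : ℝ)) ^ N *
            ((0 : ℕ) : ℝ) ^ numRelators S m d ℓ = 0 := by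
        intro N hN
        rw [Nat.cast_zero, div_zero, zero_pow (by have := (Finset.mem_Icc.1 hN).1; omega)]
        simp
      rw [Finset.sum_eq_zero hz]
      have := hx0 ℓ
      positivity
    · have hs0 : (0 : ℝ) < Fintype.card (words S m ℓ) := by
        rw [hsn]
        exact_mod_cast (Set.ncard_pos (finite_words hB ℓ)).2 hnon
      have : Nonempty (words S m ℓ) := hnon.to_subtype
      refine one_sub_le_uniformOn _ ?_
      rw [compl_compl]
      refine hbound.trans ?_
      have hgrowth := pow_le_mul_ncard_words hB hne hcard hr0.le hu1 huC hPF hℓ hnon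
      rw [← hsn] at hgrowth
      have hLle : (numRelators S m d ℓ : ℝ) ≤ (Fintype.card (words S m ℓ) : ℝ) ^ d := by
        rw [numRelators, ← hsn]
        exact Nat.floor_le (by positivity)
      have hest := density_estimate (ε := ε) (Γ := Γ) (x := ℓ) hr0 (by positivity : 0 < r * C) hs0
        hd1 hLle (by rwa [Real.rpow_natCast])
      rw [Real.rpow_natCast] at hest
      have hcodes : ((codes ℓ (8 * M + 17)).ncard : ℝ) ^ K ≤
          (7 * ((ℓ : ℝ) + 1) ^ 2) ^ ((8 * M + 17 + 1) * K) := by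
        rw [pow_mul]
        refine pow_le_pow_left₀ (Nat.cast_nonneg _) ?_ K
        exact_mod_cast (card_codes_le ℓ (8 * M + 17)).2
      have hbase : ((codes ℓ (8 * M + 17)).ncard : ℝ) ^ K * A₀ *
          ((numRelators S m d ℓ : ℝ) * r ^ ((ℓ : ℝ) - ((d + ε) * ℓ - Γ))) /
          Fintype.card (words S m ℓ) ≤ x ℓ := by
        rw [div_le_iff₀ hs0]
        calc _ ≤ (7 * ((ℓ : ℝ) + 1) ^ 2) ^ ((8 * M + 17 + 1) * K) * A₀ *
              ((r * C) ^ (1 - d) * r ^ Γ * ρ ^ ℓ * Fintype.card (words S m ℓ)) := by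
                gcongr
          _ = _ := by simp only [x, hD]; ring
      have hcardΩ : (Fintype.card (Sample S m d ℓ) : ℝ) =
          (Fintype.card (words S m ℓ) : ℝ) ^ numRelators S m d ℓ := by
        rw [Fintype.card_fun, Fintype.card_fin]
        push_cast
        rfl
      rw [hcardΩ]
      calc _ ≤ ∑ N ∈ Finset.Icc 1 K, (K : ℝ) ^ K * x ℓ ^ N *
            (Fintype.card (words S m ℓ) : ℝ) ^ numRelators S m d ℓ := by
              refine Finset.sum_le_sum fun N _ => ?_
              gcongr
        _ = (K : ℝ) ^ K * (∑ N ∈ Finset.Icc 1 K, x ℓ ^ N) *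
            (Fintype.card (words S m ℓ) : ℝ) ^ numRelators S m d ℓ := by
              rw [Finset.mul_sum, Finset.sum_mul]
        _ ≤ _ := by
              gcongr
              exact sum_pow_le_mul (hx0 ℓ) hx1 K
  have hlim : Tendsto (fun ℓ => 1 - ENNReal.ofReal ((K : ℝ) ^ K * (K * x ℓ))) atTop (𝓝 1) := by
    have h1 : Tendsto (fun ℓ => (K : ℝ) ^ K * (K * x ℓ)) atTop (𝓝 0) := by
      simpa using (hxlim.const_mul (K : ℝ)).const_mul ((K : ℝ) ^ K)
    have h2 := ENNReal.tendsto_ofReal h1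
    have h3 := ENNReal.Tendsto.sub (tendsto_const_nhds (x := (1 : ENNReal))) h2
      (Or.inl ENNReal.one_ne_top)
    simpa using h3
  refine tendsto_of_tendsto_of_tendsto_of_le_of_le' hlim tendsto_const_nhds ?_ ?_
  · filter_upwards [eventually_ge_atTop 2, hxlim.eventually (ge_mem_nhds one_pos)] with ℓ h1 h2
    exact hmain ℓ h1 h2
  · refine Eventually.of_forall fun ℓ => ?_
    exact @MeasureTheory.prob_le_one _ ⊤ _ _ _

end Estimate

end FreeProductDensity

theorem mainTheorem5 {n : ℕ} (hn : 2 ≤ n) (G : Fin n → Type*) [∀ i, Group (G i)]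
    [∀ i, Nontrivial (G i)]
    (hG : n = 2 → ∃ i, IsEmpty (G i ≃* Multiplicative (ZMod 2)))
    (S : ∀ i, Set (G i)) (hSfin : ∀ i, (S i).Finite)
    (hS : ∀ i, Subgroup.closure (S i) = ⊤)
    (m : ℕ) (hm : 1 ≤ m) (d : ℝ) (hd0 : 0 < d) (hd1 : d < 1)
    (K M : ℕ) (ε : ℝ) (hε : 0 < ε) :
    FreeProductDensity.WithOverwhelmingProbability S m d fun ℓ R =>
      ¬ ∃ Y : FreeProductDensity.AbstractDiagram ℓ,
        Y.IsReduced ∧ Y.Fulfills R ∧ Y.IsBounded K M ∧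
          (d + ε) * Y.area * ℓ < Y.relCancellation := by
  classical
  let B : ∀ i, Finset (G i) := fun i => (FreeProductDensity.finite_ball (hSfin i) m).toFinset
  have hB : ∀ i, (B i : Set (G i)) = FreeProductDensity.ball (S i) m := fun i => by simp [B]
  have hne : ∀ i, (B i).Nonempty := fun i => by
    obtain ⟨g, hg, h1⟩ := FreeProductDensity.exists_mem_ne_one (hS i)
    refine ⟨g, ?_⟩
    rw [← Finset.mem_coe, hB]
    exact FreeProductDensity.mem_ball_of_mem hm (Or.inl hg) h1
  have hcard : 2 ≤ Fintype.card (Fin n) := by rwa [Fintype.card_fin]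
  obtain ⟨r, u, C, hr, hu1, huC, hPF⟩ := FreeProductDensity.exists_perron
    (fun i => (B i).card) (fun i => (hne i).card_pos)
    (FreeProductDensity.one_lt_sum_div _ (fun i => (hne i).card_pos) (by
      rw [Fintype.card_fin]
      rcases hn.lt_or_eq with h3 | h2
      · exact Or.inl h3
      · refine Or.inr ⟨hn, ?_⟩
        obtain ⟨i, hi⟩ := hG h2.symm
        refine ⟨i, ?_⟩
        by_contra hlt
        have h1 : (FreeProductDensity.ball (S i) m).ncard = 1 := by
          rw [← hB, Set.ncard_coe_finset]
          have := (hne i).card_pos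
          omega
        obtain ⟨e⟩ := FreeProductDensity.nonempty_mulEquiv_of_ncard_ball (hS i) hm h1
        exact hi.false e))
  exact FreeProductDensity.withOverwhelmingProbability_of_perron hB hne hcard hr hu1 huC hPF hd0
    hd1 K M hε
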